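/- **Setting.** For $n\ge 1$ let $\mathbb F_n^+$ be the free unital semigroup on generators $g_1,\dots,g_n$ with identity $g_0$ and length $|\cdot|$. For $X=(X_1,\dots,X_n)\in B(\mathcal H)^n$ put $X_\alpha:=X_{i_1}\cdots X_{i_k}$ if $\alpha=g_{i_1}\cdots g_{i_k}$, and $X_{g_0}:=I$. A *positive regular free holomorphic function* in $n$ indeterminates is a series $f=\sum_{\alpha\in\mathbb F_n^+}a_\alpha X_\alpha$ with $a_\alpha\ge 0$, $a_{g_0}=0$, $a_{g_i}>0$ for $i=1,\dots,n$, and $\limsup_{k\to\infty}\big(\sum_{|\alpha|=k}|a_\alpha|^2\big)^{1/2k}<\infty$. For $m\ge 1$ and a complex Hilbert space $\mathcal H$ let $$\mathbf D_f^m(\mathcal H):=\{X\in B(\mathcal H)^n:\ (id-\Phi_{f,X})^k(I)\ge 0,\ 1\le k\le m\},\qquad \Phi_{f,X}(Y):=\sum_{k=1}^\infty\sum_{|\alpha|=k}a_\alpha X_\alpha YX_\alpha^*,$$ where membership includes the convergence of the last series in the weak operator topology for every $Y\in B(\mathcal H)$; and let $\mathbf D_{f,\mathrm{rad}}^m(\mathcal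 H):=\bigcup_{0\le r<1}r\,\mathbf D_f^m(\mathcal H)$. A map $\Psi$ from $\mathbf D_{f,\mathrm{rad}}^m(\mathcal H)$ to $B(\mathcal H)^q$ is *free holomorphic* if there are scalars $c^{(j)}_\alpha$ ($1\le j\le q$, $\alpha\in\mathbb F_n^+$) such that for every Hilbert space $\mathcal K$ the series $\sum_{k=0}^\infty\sum_{|\alpha|=k}c^{(j)}_\alpha X_\alpha$ converge in operator norm on $\mathbf D_{f,\mathrm{rad}}^m(\mathcal K)$, with sums $\Psi_j(X)$ when $\mathcal K=\mathcal H$. If $g$ is a positive regular free holomorphic function in $q\ge 1$ indeterminates and $l\ge 1$, a map $F$ from $\mathbf D_f^m(\mathcal H)$ to $B(\mathcal H)^q$ is a *free biholomorphic function* from $\mathbf D_f^m(\mathcal H)$ to $\mathbf D_g^l(\mathcal H)$ if it is a homeomorphism of $\mathbf D_f^m(\mathcal H)$ onto $\mathbf D_g^l(\mathcal H)$ in the operator norm topology and the restrictions of $F$ to $\mathbf D_{f,\mathrm{rad}}^m(\mathcal H)$ and of $F^{-1}$ to $\mathbf D_{g,\mathrm{rad}}^l(\mathcal H)$ are free holomorphic.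 Let $F^2(H_n)$ be the full Fock space on $n$ generators, with orthonormal basis $\{e_\alpha\}_{\alpha\in\mathbb F_n^+}$. The *universal model* $(W_1^{(f)},\dots,W_n^{(f)})$ of $\mathbf D_f^m$ consists of the bounded operators on $F^2(H_n)$ with $W_i^{(f)}e_\alpha=\sqrt{b_\alpha^{(m)}/b_{g_i\alpha}^{(m)}}\;e_{g_i\alpha}$, where $b_{g_0}^{(m)}:=1$ and $$b_\alpha^{(m)}:=\sum_{j=1}^{|\alpha|}\ \sum_{\gamma_1\cdots\gamma_j=\alpha,\ |\gamma_i|\ge 1}a_{\gamma_1}\cdots a_{\gamma_j}\binom{j+m-1}{m-1}\qquad(|\alpha|\ge 1).$$ The universal model $(W_1^{(g)},\dots,W_q^{(g)})$ of $\mathbf D_g^l$, on $F^2(H_q)$, is defined likewise, from the coefficients of $g$ and with $l$ in place of $m$. For a matrix $U=[u_{ij}]$ write $[X_1,\dots,X_n]U:=\big(\sum_i u_{i1}X_i,\ \sum_i u_{i2}X_i,\dots\big)$. **Theorem.** Let $f$ and $g$ be positive regular free holomorphic functions with $n\ge 1$ and $q\ge 1$ indeterminates, respectively, let $m,l\ge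 1$, and let $\mathcal H$ be a separable infinite dimensional complex Hilbert space. Assume that $\mathbf D_f^m(\mathcal H)$ and $\mathbf D_g^l(\mathcal H)$ are closed in the operator norm topology and starlike, i.e. $r\mathbf D_f^m(\mathcal H)\subseteq\mathbf D_f^m(\mathcal H)$ and $r\mathbf D_g^l(\mathcal H)\subseteq\mathbf D_g^l(\mathcal H)$ for all $r\in[0,1)$. Then a map $F:\mathbf D_f^m(\mathcal H)\to B(\mathcal H)^q$ is a free biholomorphic function from $\mathbf D_f^m(\mathcal H)$ to $\mathbf D_g^l(\mathcal H)$ with $F(0)=0$ if and only if $n=q$ and there is an invertible operator $U$ on $\mathbb C^n$ such that $$F(X_1,\dots,X_n)=[X_1,\dots,X_n]U\quad\text{for all }(X_1,\dots,X_n)\in\mathbf D_f^m(\mathcal H),$$ $$[W_1^{(f)},\dots,W_n^{(f)}]U\in\mathbf D_g^l(F^2(H_n))\quad\text{and}\quad[W_1^{(g)},\dots,W_n^{(g)}]U^{-1}\in\mathbf D_f^m(F^2(H_n)).$$ -/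

import Mathlib

open Filter Topology

noncomputable section

namespace NCDomain

universe u

/-- The free unital semigroup on `n` generators: words in the letters `0, …, n - 1`; the product
is concatenation, the identity is the empty word and `|α|` is `α.length`. -/
abbrev Word (n : ℕ) : Type := List (Fin n)

/-- `n`-tuples of bounded operators, with the (product) operator norm topology. -/
abbrev Tuple (n : ℕ) (H : Type u) [NormedAddCommGroup H] [InnerProductSpace ℂ H] : Type u :=
  Fin n → (H →L[ℂ] H)

/-- A positive regular free holomorphic function in `n` noncommuting indeterminates, given by its
coefficients `a_α`: they are nonnegative, the constant one is zero, the linear ones are positive,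
and `limsup_k (∑_{|α| = k} |a_α|²)^(1/(2k)) < ∞`, i.e. the series `∑ a_α X_α` is a free
holomorphic function on some operatorial ball of positive radius. -/
structure PositiveRegular (n : ℕ) where
  coeff : Word n → ℝ
  coeff_nonneg : ∀ α, 0 ≤ coeff α
  coeff_nil : coeff [] = 0
  coeff_letter_pos : ∀ i : Fin n, 0 < coeff [i]
  limsup_lt_top :
    limsup (fun k : ℕ => ENNReal.ofReal
      ((∑ w : Fin k → Fin n, |coeff (List.ofFn w)| ^ 2) ^ (1 / (2 * (k : ℝ))))) atTop < ⊤

section Domains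

variable {n : ℕ} {H : Type u} [NormedAddCommGroup H] [InnerProductSpace ℂ H]

/-- `X_α = X_{i₁} ⋯ X_{i_k}` for `α = g_{i₁} ⋯ g_{i_k}`, and `X_α = I` for the empty word. -/
def wordProd (X : Tuple n H) (α : Word n) : H →L[ℂ] H := (α.map X).prod

variable [CompleteSpace H]

/-- The partial sum `∑_{1 ≤ k ≤ N} ∑_{|α| = k} a_α X_α Y X_α^*`. -/
def phiPartial (f : PositiveRegular n) (X : Tuple n H) (Y : H →L[ℂ] H) (N : ℕ) : H →L[ℂ] H :=
  ∑ k ∈ Finset.Icc 1 N, ∑ w : Fin k → Fin n,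
    (f.coeff (List.ofFn w) : ℂ) •
      (wordProd X (List.ofFn w) * Y * ContinuousLinearMap.adjoint (wordProd X (List.ofFn w)))

/-- The series defining `Φ_{f,X}(Y)` converges in the weak operator topology for every `Y`. -/
def PhiConverges (f : PositiveRegular n) (X : Tuple n H) : Prop :=
  ∀ Y : H →L[ℂ] H, ∃ Z : H →L[ℂ] H,
    Tendsto (fun N => ContinuousLinearMapWOT.ofCLM (phiPartial f X Y N)) atTop
      (𝓝 (ContinuousLinearMapWOT.ofCLM Z))

/-- `Φ_{f,X}(Y) = ∑_{k ≥ 1} ∑_{|α| = k} a_α X_α Y X_α^*`, the limit being taken in the weak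
operator topology (used only together with `PhiConverges f X`). -/
def Phi (f : PositiveRegular n) (X : Tuple n H) (Y : H →L[ℂ] H) : H →L[ℂ] H :=
  ContinuousLinearMapWOT.toCLM
    (limUnder atTop fun N => ContinuousLinearMapWOT.ofCLM (phiPartial f X Y N))

/-- The noncommutative domain `D_f^m(H)`: all `X` for which `Φ_{f,X}` is defined and
`(id - Φ_{f,X})^k (I) ≥ 0` for `1 ≤ k ≤ m`. -/
def domain (f : PositiveRegular n) (m : ℕ) (H : Type u) [NormedAddCommGroup H]
    [InnerProductSpace ℂ H] [CompleteSpace H] : Set (Tuple n H) :=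
  {X | PhiConverges f X ∧
    ∀ k : ℕ, 1 ≤ k → k ≤ m → ((fun Y => Y - Phi f X Y)^[k] 1).IsPositive}

/-- The radial part `⋃_{0 ≤ r < 1} r D_f^m(H)`. -/
def radialDomain (f : PositiveRegular n) (m : ℕ) (H : Type u) [NormedAddCommGroup H]
    [InnerProductSpace ℂ H] [CompleteSpace H] : Set (Tuple n H) :=
  {X | ∃ r : ℝ, 0 ≤ r ∧ r < 1 ∧ ∃ Y ∈ domain f m H, X = (r : ℂ) • Y}

/-- `r D ⊆ D` for every `r ∈ [0, 1)`. -/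
def IsStarlike (D : Set (Tuple n H)) : Prop :=
  ∀ X ∈ D, ∀ r : ℝ, 0 ≤ r → r < 1 → (r : ℂ) • X ∈ D

end Domains

section FreeHolomorphic

/-- `∑_{k ≥ 0} ∑_{|α| = k} c_α X_α = T`, the outer series converging in operator norm. -/
def SeriesHasSum {n : ℕ} {H : Type u} [NormedAddCommGroup H] [InnerProductSpace ℂ H]
    (c : Word n → ℂ) (X : Tuple n H) (T : H →L[ℂ] H) : Prop :=
  Tendsto (fun N : ℕ => ∑ k ∈ Finset.range N, ∑ w : Fin k → Fin n,
    c (List.ofFn w) • wordProd X (List.ofFn w)) atTop (𝓝 T)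

/-- `F` restricts to a free holomorphic function on the radial part of `D_f^m(H)`, with values in
`q`-tuples: there are `q` formal power series with scalar coefficients whose representations on
the radial part over every Hilbert space `K` converge in operator norm, and which give `F` on the
radial part over `H`. -/
def IsFreeHolomorphic {n q : ℕ} (f : PositiveRegular n) (m : ℕ)
    {H : Type u} [NormedAddCommGroup H] [InnerProductSpace ℂ H] [CompleteSpace H]
    (F : Tuple n H → Tuple q H) : Prop :=
  ∃ c : Fin q → Word n → ℂ,
    (∀ (K : Type u) [NormedAddCommGroup K] [InnerProductSpace ℂ K] [CompleteSpace K],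
      ∀ X ∈ radialDomain f m K, ∀ j, ∃ T : K →L[ℂ] K, SeriesHasSum (c j) X T) ∧
    ∀ X ∈ radialDomain f m H, ∀ j, SeriesHasSum (c j) X (F X j)

/-- `F` (only its values on `D_f^m(H)` matter) is a free biholomorphic function from `D_f^m(H)`
onto `D_g^l(H)`: it is a homeomorphism between these sets for the operator norm topologies, and it
and its inverse `G` restrict to free holomorphic functions on the radial parts. -/
def IsFreeBiholomorphic {n q : ℕ} (f : PositiveRegular n) (m : ℕ) (g : PositiveRegular q) (l : ℕ)
    {H : Type u} [NormedAddCommGroup H] [InnerProductSpace ℂ H] [CompleteSpace H]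
    (F : Tuple n H → Tuple q H) : Prop :=
  ∃ G : Tuple q H → Tuple n H,
    Set.MapsTo F (domain f m H) (domain g l H) ∧
    Set.MapsTo G (domain g l H) (domain f m H) ∧
    Set.InvOn G F (domain f m H) (domain g l H) ∧
    ContinuousOn F (domain f m H) ∧
    ContinuousOn G (domain g l H) ∧
    IsFreeHolomorphic f m F ∧
    IsFreeHolomorphic g l G

/-- `[X_1, …, X_n] U = (∑_i u_{i1} X_i, …, ∑_i u_{iq} X_i)`. -/
def rowMul {n q : ℕ} {H : Type u} [NormedAddCommGroup H] [InnerProductSpace ℂ H]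
    (X : Tuple n H) (U : Matrix (Fin n) (Fin q) ℂ) : Tuple q H :=
  fun j => ∑ i, U i j • X i

end FreeHolomorphic

section UniversalModel

/-- The full Fock space `F²(H_n)`, realized through its orthonormal basis `(e_α)` indexed by
words as the space of square summable families `(x_α)`. -/
abbrev Fock (n : ℕ) : Type := lp (fun _ : Word n => ℂ) 2

/-- The basis vector `e_α = e_{i₁} ⊗ ⋯ ⊗ e_{i_k}` of the full Fock space. -/
def fockBasis {n : ℕ} (α : Word n) : Fock n := lp.single 2 α (1 : ℂ)

variable {n : ℕ}

/-- `∑ a_{γ_1} ⋯ a_{γ_j}` over all factorizations `γ_1 ⋯ γ_j = α` into `j` nonempty words, by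
recursion on `j`: the first factor `γ_1` consists of the first `k + 1` letters of `α`. -/
def factorSum (f : PositiveRegular n) : ℕ → Word n → ℝ
  | 0, α => if α = [] then 1 else 0
  | j + 1, α =>
    ∑ k ∈ Finset.range α.length, f.coeff (α.take (k + 1)) * factorSum f j (α.drop (k + 1))

/-- `b_α^{(m)}`: equal to `1` for the empty word, and otherwise to the sum over `1 ≤ j ≤ |α|` and
over `γ_1 ⋯ γ_j = α` with all `|γ_i| ≥ 1` of `a_{γ_1} ⋯ a_{γ_j} binom (j + m - 1) (m - 1)`. -/
def bCoeff (f : PositiveRegular n) (m : ℕ) (α : Word n) : ℝ :=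
  if α = [] then 1
  else ∑ j ∈ Finset.Icc 1 α.length, factorSum f j α * ((j + m - 1).choose (m - 1) : ℝ)

lemma factorSum_nonneg (f : PositiveRegular n) (j : ℕ) (α : Word n) : 0 ≤ factorSum f j α := by
  induction j generalizing α with
  | zero => simp only [factorSum]; split_ifs <;> norm_num
  | succ j ih =>
    exact Finset.sum_nonneg fun k _ => mul_nonneg (f.coeff_nonneg _) (ih _)

lemma bCoeff_nonneg (f : PositiveRegular n) (m : ℕ) (α : Word n) : 0 ≤ bCoeff f m α := by
  unfold bCoeff
  split_ifs
  · norm_num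
  · exact Finset.sum_nonneg fun j _ => mul_nonneg (factorSum_nonneg f j α) (Nat.cast_nonneg _)

lemma factorSum_cons_ge (f : PositiveRegular n) (i : Fin n) (j : ℕ) (α : Word n) :
    f.coeff [i] * factorSum f j α ≤ factorSum f (j + 1) (i :: α) := by
  have h := Finset.single_le_sum
    (f := fun k => f.coeff ((i :: α).take (k + 1)) * factorSum f j ((i :: α).drop (k + 1)))
    (s := Finset.range (i :: α).length)
    (fun k _ => mul_nonneg (f.coeff_nonneg _) (factorSum_nonneg f j _))
    (Finset.mem_range.2 (by simp : 0 < (i :: α).length))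
  simpa [factorSum] using h

lemma bCoeff_cons_ge (f : PositiveRegular n) (m : ℕ) (i : Fin n) (α : Word n) :
    f.coeff [i] * bCoeff f m α ≤ bCoeff f m (i :: α) := by
  have ha := (f.coeff_letter_pos i).le
  have hmono : ∀ j : ℕ, (((j + m - 1).choose (m - 1) : ℕ) : ℝ) ≤
      (((j + 1 + m - 1).choose (m - 1) : ℕ) : ℝ) := fun j => by
    exact_mod_cast Nat.choose_le_choose _ (by omega)
  have hterm : ∀ j : ℕ, f.coeff [i] * (factorSum f j α * ((j + m - 1).choose (m - 1) : ℝ)) ≤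
      factorSum f (j + 1) (i :: α) * ((j + 1 + m - 1).choose (m - 1) : ℝ) := fun j => by
    rw [← mul_assoc]
    exact mul_le_mul (factorSum_cons_ge f i j α) (hmono j) (Nat.cast_nonneg _)
      (factorSum_nonneg f _ _)
  have hnn : ∀ j : ℕ, 0 ≤ factorSum f j (i :: α) * ((j + m - 1).choose (m - 1) : ℝ) :=
    fun j => mul_nonneg (factorSum_nonneg f _ _) (Nat.cast_nonneg _)
  by_cases hα : α = []
  · subst hα
    have h0 := hterm 0
    simp only [bCoeff, factorSum, if_true, List.length_cons, List.length_nil,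
      Nat.zero_add, reduceCtorEq, if_false, Finset.Icc_self, Finset.sum_singleton] at h0 ⊢
    simpa using h0
  · simp only [bCoeff, hα, reduceCtorEq, if_false, List.length_cons, Finset.mul_sum]
    calc _ ≤ ∑ j ∈ Finset.Icc 1 α.length,
          factorSum f (j + 1) (i :: α) * ((j + 1 + m - 1).choose (m - 1) : ℝ) :=
          Finset.sum_le_sum fun j _ => hterm j
      _ = ∑ j ∈ (Finset.Icc 1 α.length).image (· + 1),
          factorSum f j (i :: α) * ((j + m - 1).choose (m - 1) : ℝ) := by
          rw [Finset.sum_image (fun a _ b _ h => by simpa using h)]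
      _ ≤ _ := by
          refine Finset.sum_le_sum_of_subset_of_nonneg ?_ fun j _ _ => hnn j
          intro j hj
          simp only [Finset.mem_image, Finset.mem_Icc] at hj ⊢
          omega

/-- The weight `√(b_α^{(m)} / b_{g_i α}^{(m)})`. -/
def modelWeight (f : PositiveRegular n) (m : ℕ) (i : Fin n) (α : Word n) : ℝ :=
  √(bCoeff f m α / bCoeff f m (i :: α))

lemma modelWeight_le (f : PositiveRegular n) (m : ℕ) (i : Fin n) (α : Word n) :
    modelWeight f m i α ≤ √(1 / f.coeff [i]) := by
  apply Real.sqrt_le_sqrt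
  have ha := f.coeff_letter_pos i
  have hge := bCoeff_cons_ge f m i α
  rcases (bCoeff_nonneg f m (i :: α)).eq_or_lt with h | h
  · rw [← h, div_zero]; positivity
  · rw [div_le_div_iff₀ h ha]; linarith

/-- The coordinates of `W_i x`: that at `g_i α` is `√(b_α / b_{g_i α}) x_α`, and those at words
which do not begin with `g_i` vanish. -/
def modelCoord (f : PositiveRegular n) (m : ℕ) (i : Fin n) (x : Word n → ℂ) : Word n → ℂ
  | [] => 0
  | j :: α => if j = i then (modelWeight f m i α : ℂ) * x α else 0

lemma modelCoord_hasSum (f : PositiveRegular n) (m : ℕ) (i : Fin n) (x : Fock n) :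
    Summable (fun β => ‖modelCoord f m i x β‖ ^ 2) ∧
      ∑' β, ‖modelCoord f m i x β‖ ^ 2 ≤ (√(1 / f.coeff [i]) * ‖x‖) ^ 2 := by
  have hinj : Function.Injective (fun α : Word n => i :: α) := fun a b h => by simpa using h
  have hzero : ∀ β, β ∉ Set.range (fun α : Word n => i :: α) →
      ‖modelCoord f m i x β‖ ^ 2 = 0 := by
    rintro (_ | ⟨j, α⟩) hβ
    · simp [modelCoord]
    · have : j ≠ i := by rintro rfl; exact hβ ⟨α, rfl⟩
      simp [modelCoord, this]
  have hx : HasSum (fun α => ‖x α‖ ^ 2) (‖x‖ ^ 2) := by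
    have := lp.hasSum_norm (p := 2) (by norm_num) x
    simpa using this
  have hle : ∀ α, ‖modelCoord f m i x (i :: α)‖ ^ 2 ≤ √(1 / f.coeff [i]) ^ 2 * ‖x α‖ ^ 2 := by
    intro α
    have h0 : 0 ≤ modelWeight f m i α := Real.sqrt_nonneg _
    simp only [modelCoord, if_true, norm_mul, Complex.norm_real, Real.norm_eq_abs, mul_pow,
      abs_of_nonneg h0]
    have := modelWeight_le f m i α
    gcongr
  have hs : Summable (fun α => ‖modelCoord f m i x (i :: α)‖ ^ 2) :=
    Summable.of_nonneg_of_le (fun _ => by positivity) hle (hx.summable.mul_left _)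
  refine ⟨(hinj.summable_iff hzero).1 hs, ?_⟩
  rw [← hinj.tsum_eq (f := fun β => ‖modelCoord f m i x β‖ ^ 2)
    (fun β hβ => by_contra fun h => hβ (hzero β h))]
  calc _ ≤ ∑' α, √(1 / f.coeff [i]) ^ 2 * ‖x α‖ ^ 2 :=
        hs.tsum_le_tsum hle (hx.summable.mul_left _)
    _ = _ := by rw [tsum_mul_left, hx.tsum_eq, mul_pow]

/-- The weighted left creation operator `W_i` on the full Fock space associated with `D_f^m`,
determined by `W_i e_α = √(b_α^{(m)} / b_{g_i α}^{(m)}) e_{g_i α}`. -/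
def model (f : PositiveRegular n) (m : ℕ) : Tuple n (Fock n) := fun i =>
  LinearMap.mkContinuous
    { toFun := fun x => (⟨modelCoord f m i x, by
        refine (memℓp_gen_iff (by norm_num)).2 ?_
        simpa using (modelCoord_hasSum f m i x).1⟩ : Fock n)
      map_add' := fun x y => by
        ext β
        change modelCoord f m i (fun α => x α + y α) β =
          modelCoord f m i x β + modelCoord f m i y β
        rcases β with _ | ⟨j, α⟩
        · simp [modelCoord]
        · by_cases h : j = i <;> simp [modelCoord, h, mul_add]
      map_smul' := fun c x => by
        ext β
        change modelCoord f m i (fun α => c * x α) β = c * modelCoord f m i x β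
        rcases β with _ | ⟨j, α⟩
        · simp [modelCoord]
        · by_cases h : j = i <;> simp [modelCoord, h, mul_left_comm] }
    (√(1 / f.coeff [i]))
    (fun x => by
      refine le_of_sq_le_sq ?_ (by positivity)
      refine le_trans (le_of_eq ?_) (modelCoord_hasSum f m i x).2
      have := lp.norm_rpow_eq_tsum (p := 2) (by norm_num)
        (⟨modelCoord f m i x, by
          refine (memℓp_gen_iff (by norm_num)).2 ?_
          simpa using (modelCoord_hasSum f m i x).1⟩ : Fock n)
      simpa using this)

theorem model_apply_fockBasis (f : PositiveRegular n) (m : ℕ) (i : Fin n) (α : Word n) :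
    model f m i (fockBasis α) =
      ((√(bCoeff f m α / bCoeff f m (i :: α)) : ℝ) : ℂ) • fockBasis (i :: α) := by
  ext β
  change modelCoord f m i (Pi.single α (1 : ℂ) : Word n → ℂ) β =
    (modelWeight f m i α : ℂ) * (Pi.single (i :: α) (1 : ℂ) : Word n → ℂ) β
  rcases β with _ | ⟨j, β⟩
  · simp [modelCoord, Pi.single_apply]
  · by_cases h : j = i <;> by_cases h' : β = α <;> simp [modelCoord, Pi.single_apply, h, h']

end UniversalModel

end NCDomain

end

open NCDomain

/-!
The domain `D_f^m` is studied through the real quadratic forms `quad Y h = Re ⟪h, Y h⟫`. Weak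
convergence of `Φ_{f,X}` amounts to a bound `∑ a_α ‖X_α^* h‖² ≤ C ‖h‖²` (`PhiBound`), which makes
`Φ_{f,X}` a bounded operator on `B(H)` of norm at most `C`, and membership in `D_f^m` becomes
nonnegativity of the forms of the defects `(id - Φ_{f,X})^k (I)` (`mem_domain_iff`).

*Linear maps that respect the models are biholomorphic.* If `X ∈ D_f^m` and `0 ≤ r < 1`, then
`‖Φ_{f,rX}‖ ≤ r² < 1`, so the binomial series gives `I = ∑ b_α T_α Δ T_α^*` for `T = rX` and its
defect `Δ` of order `m`. Hence `T` has a Poisson kernel (`exists_poissonKernel`): an isometry into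
a multiple of the Fock space intertwining `T_i^*` with the inflation of `W_i^*`. It also
intertwines `(TU)_j^*` with `(WU)_j^*`, and membership in `D_g^l` passes from `WU` to such a
compression (`IsKernelFamily.mem_domain`). Letting `r → 1` in the closed set `D_g^l` shows that
`X ↦ XU` maps `D_f^m` into `D_g^l` (`mapsTo_rowMul`); the inverse is treated alike.

*Biholomorphic maps fixing the origin are linear.* This is Cartan's theorem for bounded circular
domains, and here it can be proved on nilpotent tuples, where all series are finite sums, so that
no composition of power series has to be justified. Let `U` be the linear part of `F`, with inverse
`V`, and let `F_k` be the first nonzero homogeneous part of degree `k ≥ 2`. If all products of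
more than `k` entries of `X ∈ D_f^m` vanish, then `F(X) = XU + F_k(X)`. For `z^{k-1} = -1`, the
point `F^{-1}(z^{-1} F(zX))` of the domain equals `X - 2 F_k(X) V` (`rotate_mem_domain`). It has
the same part `F_k`, so iteration yields the points `X - 2N F_k(X) V`; as the domain is bounded,
`F_k(X) = 0`. Small multiples of truncated shifts on an orthonormal basis indexed by words are
nilpotent points of the domain that detect every coefficient of `F_k`, so `F_k = 0`.

Once `F` is linear, it maps a copy of the universal model on `H` into `D_g^l(H)`, because the
universal model belongs to its own domain (`model_mem_domain`): on diagonal operators,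
`Φ_{f,W}` is multiplication of power series by `f`, so the defects of `W` have the coefficients
of `(1 - f)^{-(m - k)}`, which are nonnegative.
-/

noncomputable section

namespace NCDomain

universe u v

open scoped InnerProductSpace

/-! ### Sums over words -/

section Words

variable {n : ℕ} {E : Type*} [AddCommMonoid E]

/-- The finite set of words of length at most `N`. -/
def wordsUpTo (n N : ℕ) : Finset (Word n) :=
  (Finset.range (N + 1)).biUnion fun k =>
    Finset.univ.image (List.ofFn : (Fin k → Fin n) → Word n)

lemma mem_wordsUpTo {N : ℕ} {α : Word n} : α ∈ wordsUpTo n N ↔ α.length ≤ N := by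
  simp only [wordsUpTo, Finset.mem_biUnion, Finset.mem_range, Finset.mem_image, Finset.mem_univ,
    true_and]
  constructor
  · rintro ⟨k, hk, w, rfl⟩
    simp only [List.length_ofFn]
    omega
  · exact fun h => ⟨α.length, by omega, α.get, List.ofFn_get α⟩

lemma sum_wordsUpTo (c : Word n → E) (N : ℕ) :
    ∑ α ∈ wordsUpTo n N, c α =
      ∑ k ∈ Finset.range (N + 1), ∑ w : Fin k → Fin n, c (List.ofFn w) := by
  rw [wordsUpTo, Finset.sum_biUnion]
  · exact Finset.sum_congr rfl fun k _ =>
      Finset.sum_image fun a _ b _ h => List.ofFn_injective h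
  · intro k _ l _ hkl
    refine Finset.disjoint_left.2 fun α hα hα' => hkl ?_
    simp only [Finset.mem_image, Finset.mem_univ, true_and] at hα hα'
    obtain ⟨w, rfl⟩ := hα
    obtain ⟨w', h⟩ := hα'
    simpa using (congrArg List.length h).symm

lemma sum_Icc_words (c : Word n → E) (hc : c [] = 0) (N : ℕ) :
    ∑ k ∈ Finset.Icc 1 N, ∑ w : Fin k → Fin n, c (List.ofFn w) = ∑ α ∈ wordsUpTo n N, c α := by
  rw [sum_wordsUpTo, Finset.range_eq_Ico, Finset.sum_eq_sum_Ico_succ_bot (by omega)]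
  simp only [List.ofFn_zero, hc, Finset.sum_const_zero, zero_add]
  rfl

lemma tendsto_wordsUpTo : Tendsto (wordsUpTo n) atTop atTop :=
  tendsto_atTop_finset_of_monotone
    (fun _ _ h _ hα => mem_wordsUpTo.2 ((mem_wordsUpTo.1 hα).trans h))
    fun α => ⟨α.length, mem_wordsUpTo.2 le_rfl⟩

end Words

/-! ### Column operators -/

section Column

variable {ι : Type*} {H : Type*} [NormedAddCommGroup H] [InnerProductSpace ℂ H]
  {K : Type*} [NormedAddCommGroup K] [InnerProductSpace ℂ K]

/-- The column operator `h ↦ (A_i h)_i` from `H` to the Hilbert space of square summable families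
in `K`, for a family of operators with `∑ ‖A_i h‖² ≤ C² ‖h‖²`. -/
def column (A : ι → H →L[ℂ] K) (C : ℝ) (hC : 0 ≤ C)
    (hA : ∀ h (s : Finset ι), ∑ i ∈ s, ‖A i h‖ ^ 2 ≤ C ^ 2 * ‖h‖ ^ 2) :
    H →L[ℂ] lp (fun _ : ι => K) 2 :=
  have hmem : ∀ h, Memℓp (fun i => A i h) 2 := fun h =>
    memℓp_gen_iff (by norm_num) |>.2 (by
      simpa using summable_of_sum_le (fun i => by positivity) (hA h))
  LinearMap.mkContinuous
    { toFun := fun h => (⟨fun i => A i h, hmem h⟩ : lp (fun _ : ι => K) 2)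
      map_add' := fun x y => by ext i; exact (A i).map_add x y
      map_smul' := fun c x => by ext i; exact (A i).map_smul c x }
    C
    (fun h => by
      refine le_of_sq_le_sq ?_ (by positivity)
      have h1 := lp.norm_rpow_eq_tsum (p := 2) (by norm_num)
        (⟨fun i => A i h, hmem h⟩ : lp (fun _ : ι => K) 2)
      have h2 : ‖(⟨fun i => A i h, hmem h⟩ : lp (fun _ : ι => K) 2)‖ ^ 2 =
          ∑' i, ‖A i h‖ ^ 2 := by simpa using h1
      refine le_trans (le_of_eq h2) ?_
      rw [mul_pow]
      exact Real.tsum_le_of_sum_le (fun i => by positivity) (hA h))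

variable (A : ι → H →L[ℂ] K) (C : ℝ) (hC : 0 ≤ C)
    (hA : ∀ h (s : Finset ι), ∑ i ∈ s, ‖A i h‖ ^ 2 ≤ C ^ 2 * ‖h‖ ^ 2)

@[simp] lemma column_apply (h : H) (i : ι) : column A C hC hA h i = A i h := rfl

lemma norm_column_le : ‖column A C hC hA‖ ≤ C := by
  unfold column
  exact LinearMap.mkContinuous_norm_le _ hC _

end Column

/-! ### Quadratic forms of operators -/

section Quad

variable {H : Type*} [NormedAddCommGroup H] [InnerProductSpace ℂ H]

/-- The real part `Re ⟪h, Y h⟫` of the quadratic form of an operator. -/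
def quad (Y : H →L[ℂ] H) (h : H) : ℝ := (⟪h, Y h⟫_ℂ).re

lemma quad_one (h : H) : quad 1 h = ‖h‖ ^ 2 := by
  have := inner_self_eq_norm_sq (𝕜 := ℂ) h
  simpa [quad] using this

lemma quad_sub (Y Z : H →L[ℂ] H) (h : H) : quad (Y - Z) h = quad Y h - quad Z h := by
  simp [quad]

lemma abs_quad_le (Y : H →L[ℂ] H) (h : H) : |quad Y h| ≤ ‖Y‖ * ‖h‖ ^ 2 := by
  refine (Complex.abs_re_le_norm _).trans ((norm_inner_le_norm _ _).trans ?_)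
  have := Y.le_opNorm h
  nlinarith [norm_nonneg h]

lemma isPositive_iff_quad [CompleteSpace H] {Y : H →L[ℂ] H} (hY : IsSelfAdjoint Y) :
    Y.IsPositive ↔ ∀ h, 0 ≤ quad Y h := by
  rw [ContinuousLinearMap.isPositive_def']
  refine ⟨fun hp h => ?_, fun hp => ⟨hY, fun h => ?_⟩⟩
  · have := hp.2 h
    rwa [ContinuousLinearMap.reApplyInnerSelf_apply, inner_re_symm] at this
  · rw [ContinuousLinearMap.reApplyInnerSelf_apply, inner_re_symm]
    exact hp h

lemma quad_nonneg [CompleteSpace H] {Y : H →L[ℂ] H}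
    (hY : Y.IsPositive) (h : H) : 0 ≤ quad Y h :=
  (isPositive_iff_quad hY.isSelfAdjoint).1 hY h

end Quad

/-! ### Words in operator tuples -/

section WordProd

variable {n : ℕ} {H : Type u} [NormedAddCommGroup H] [InnerProductSpace ℂ H]

@[simp] lemma wordProd_nil (X : Tuple n H) : wordProd X [] = 1 := by simp [wordProd]

lemma wordProd_append (X : Tuple n H) (α β : Word n) :
    wordProd X (α ++ β) = wordProd X α * wordProd X β := by simp [wordProd]

lemma wordProd_cons (X : Tuple n H) (i : Fin n) (β : Word n) :
    wordProd X (i :: β) = X i * wordProd X β := by simp [wordProd]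

lemma wordProd_smul (z : ℂ) (X : Tuple n H) (α : Word n) :
    wordProd (z • X) α = z ^ α.length • wordProd X α := by
  induction α with
  | nil => simp [wordProd]
  | cons i α ih => simp [wordProd_cons, ih, pow_succ, smul_smul]

end WordProd

/-! ### The map `Φ_{f,X}` and membership in the domains -/

section Phi

variable {n : ℕ} {H : Type u} [NormedAddCommGroup H] [InnerProductSpace ℂ H] [CompleteSpace H]

/-- The adjoint `X_α^*` of a word in the entries of `X`. -/
def wordAdj (X : Tuple n H) (α : Word n) : H →L[ℂ] H :=
  ContinuousLinearMap.adjoint (wordProd X α)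

@[simp] lemma wordAdj_nil (X : Tuple n H) : wordAdj X [] = 1 := by
  simp only [wordAdj, wordProd, List.map_nil, List.prod_nil]
  exact star_one _

lemma wordAdj_append (X : Tuple n H) (α β : Word n) :
    wordAdj X (α ++ β) = wordAdj X β * wordAdj X α := by
  rw [wordAdj, wordProd_append]
  exact star_mul _ _

lemma wordAdj_cons (X : Tuple n H) (i : Fin n) (β : Word n) :
    wordAdj X (i :: β) = wordAdj X β * ContinuousLinearMap.adjoint (X i) := by
  rw [wordAdj, wordProd_cons]
  exact star_mul _ _

lemma wordAdj_smul (z : ℂ) (X : Tuple n H) (α : Word n) :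
    wordAdj (z • X) α = (starRingEnd ℂ z) ^ α.length • wordAdj X α := by
  rw [wordAdj, wordProd_smul, map_smulₛₗ, map_pow, wordAdj]

lemma phiPartial_eq (f : PositiveRegular n) (X : Tuple n H) (Y : H →L[ℂ] H) (N : ℕ) :
    phiPartial f X Y N = ∑ α ∈ wordsUpTo n N,
      (f.coeff α : ℂ) • (wordProd X α * Y * wordAdj X α) :=
  sum_Icc_words (fun α => (f.coeff α : ℂ) • (wordProd X α * Y * wordAdj X α))
    (by simp [f.coeff_nil]) N

lemma inner_phiPartial (f : PositiveRegular n) (X : Tuple n H) (Y : H →L[ℂ] H) (N : ℕ)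
    (h h' : H) : ⟪h', phiPartial f X Y N h⟫_ℂ = ∑ α ∈ wordsUpTo n N,
      (f.coeff α : ℂ) * ⟪wordAdj X α h', Y (wordAdj X α h)⟫_ℂ := by
  rw [phiPartial_eq, sum_apply, inner_sum]
  refine Finset.sum_congr rfl fun α _ => ?_
  rw [smul_apply, inner_smul_right]
  simp only [mul_apply_eq_comp, wordAdj, ContinuousLinearMap.adjoint_inner_left]

/-- The quantitative form of the convergence of `Φ_{f,X}`: the sums of `a_α ‖X_α^* h‖²` are
bounded by `C ‖h‖²`. The bound on the sums implies `0 ≤ C` only if `H` is nontrivial. -/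
def PhiBound (f : PositiveRegular n) (X : Tuple n H) (C : ℝ) : Prop :=
  0 ≤ C ∧ ∀ h (s : Finset (Word n)), ∑ α ∈ s, f.coeff α * ‖wordAdj X α h‖ ^ 2 ≤ C * ‖h‖ ^ 2

variable {f : PositiveRegular n} {X : Tuple n H} {C : ℝ}

lemma PhiBound.mono {C' : ℝ} (hb : PhiBound f X C) (h : C ≤ C') : PhiBound f X C' :=
  ⟨hb.1.trans h, fun x s => (hb.2 x s).trans (mul_le_mul_of_nonneg_right h (by positivity))⟩

lemma PhiBound.summable (hb : PhiBound f X C) (h : H) :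
    Summable fun α => f.coeff α * ‖wordAdj X α h‖ ^ 2 :=
  summable_of_sum_le (fun α => mul_nonneg (f.coeff_nonneg α) (by positivity)) (hb.2 h)

lemma PhiBound.exists_hasSum (hb : PhiBound f X C) (Y : H →L[ℂ] H) :
    ∃ Z : H →L[ℂ] H, ‖Z‖ ≤ C * ‖Y‖ ∧ ∀ h h',
      HasSum (fun α => (f.coeff α : ℂ) * ⟪wordAdj X α h', Y (wordAdj X α h)⟫_ℂ) ⟪h', Z h⟫_ℂ := by
  have hsq : ∀ (α : Word n) (h : H), ‖((√(f.coeff α) : ℂ) • wordAdj X α) h‖ ^ 2 =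
      f.coeff α * ‖wordAdj X α h‖ ^ 2 := fun α h => by
    rw [smul_apply, norm_smul, mul_pow, Complex.norm_real, Real.norm_eq_abs,
      sq_abs, Real.sq_sqrt (f.coeff_nonneg α)]
  have h1 : ∀ h (s : Finset (Word n)),
      ∑ α ∈ s, ‖((√(f.coeff α) : ℂ) • wordAdj X α) h‖ ^ 2 ≤ √C ^ 2 * ‖h‖ ^ 2 := fun h s => by
    simp only [hsq, Real.sq_sqrt hb.1]
    exact hb.2 h s
  have h2 : ∀ h (s : Finset (Word n)),
      ∑ α ∈ s, ‖(Y * ((√(f.coeff α) : ℂ) • wordAdj X α)) h‖ ^ 2 ≤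
        (‖Y‖ * √C) ^ 2 * ‖h‖ ^ 2 := fun h s => by
    rw [mul_pow, mul_assoc]
    refine le_trans ?_ (mul_le_mul_of_nonneg_left (h1 h s) (by positivity))
    rw [Finset.mul_sum]
    refine Finset.sum_le_sum fun α _ => ?_
    rw [← mul_pow]
    exact pow_le_pow_left₀ (norm_nonneg _) (Y.le_opNorm _) 2
  set R := column _ _ (Real.sqrt_nonneg C) h1
  set S := column _ _ (by positivity : 0 ≤ ‖Y‖ * √C) h2
  refine ⟨(ContinuousLinearMap.adjoint R).comp S, ?_, fun h h' => ?_⟩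
  · refine (ContinuousLinearMap.opNorm_comp_le _ _).trans ?_
    rw [LinearIsometryEquiv.norm_map]
    refine (mul_le_mul (norm_column_le _ _ _ _) (norm_column_le _ _ _ _)
      (ContinuousLinearMap.opNorm_nonneg _)
      (Real.sqrt_nonneg _)).trans (le_of_eq ?_)
    rw [mul_left_comm, Real.mul_self_sqrt hb.1, mul_comm]
  · rw [ContinuousLinearMap.comp_apply, ContinuousLinearMap.adjoint_inner_right]
    have := lp.hasSum_inner (𝕜 := ℂ) (R h') (S h)
    convert! this using 2 with α
    simp only [R, S, column_apply, smul_apply, mul_apply_eq_comp,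
      map_smul, inner_smul_left, inner_smul_right, Complex.conj_ofReal]
    rw [← mul_assoc, ← Complex.ofReal_mul, Real.mul_self_sqrt (f.coeff_nonneg α)]

lemma tendsto_phiPartial {Y Z : H →L[ℂ] H} (hZ : ∀ h h',
    HasSum (fun α => (f.coeff α : ℂ) * ⟪wordAdj X α h', Y (wordAdj X α h)⟫_ℂ) ⟪h', Z h⟫_ℂ) :
    Tendsto (fun N => ContinuousLinearMapWOT.ofCLM (phiPartial f X Y N)) atTop
      (𝓝 (ContinuousLinearMapWOT.ofCLM Z)) := by
  rw [ContinuousLinearMapWOT.tendsto_iff_forall_inner_apply_tendsto]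
  intro h h'
  simp only [ContinuousLinearMapWOT.ofCLM_apply, inner_phiPartial]
  exact (hZ h h').comp tendsto_wordsUpTo

lemma PhiBound.phiConverges (hb : PhiBound f X C) : PhiConverges f X := fun Y => by
  obtain ⟨Z, -, hZ⟩ := hb.exists_hasSum Y
  exact ⟨Z, tendsto_phiPartial hZ⟩

lemma PhiBound.norm_phi_le_and_hasSum (hb : PhiBound f X C) (Y : H →L[ℂ] H) :
    ‖Phi f X Y‖ ≤ C * ‖Y‖ ∧ ∀ h h',
      HasSum (fun α => (f.coeff α : ℂ) * ⟪wordAdj X α h', Y (wordAdj X α h)⟫_ℂ)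
        ⟪h', Phi f X Y h⟫_ℂ := by
  obtain ⟨Z, hn, hZ⟩ := hb.exists_hasSum Y
  have : Phi f X Y = Z := by
    rw [Phi, (tendsto_phiPartial hZ).limUnder_eq]
  rw [this]
  exact ⟨hn, hZ⟩

/-- The weak convergence of `Φ_{f,X}(I)` alone bounds the sums `∑ a_α ‖X_α^* h‖²`, because these
increase to its quadratic form. -/
lemma PhiConverges.exists_phiBound (hc : PhiConverges f X) : ∃ C, PhiBound f X C := by
  obtain ⟨Z, hZ⟩ := hc 1
  refine ⟨‖Z‖, norm_nonneg _, fun h s => ?_⟩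
  rw [ContinuousLinearMapWOT.tendsto_iff_forall_inner_apply_tendsto] at hZ
  have h1 := (Complex.continuous_re.tendsto _).comp (hZ h h)
  have h2 : ∀ N, (⟪h, phiPartial f X 1 N h⟫_ℂ).re =
      ∑ α ∈ wordsUpTo n N, f.coeff α * ‖wordAdj X α h‖ ^ 2 := fun N => by
    rw [inner_phiPartial, Complex.re_sum]
    refine Finset.sum_congr rfl fun α _ => ?_
    rw [Complex.re_ofReal_mul, ← quad_one, quad]
  have h3 : Tendsto (fun N => ∑ α ∈ wordsUpTo n N, f.coeff α * ‖wordAdj X α h‖ ^ 2) atTop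
      (𝓝 (quad Z h)) := by
    simp only [← h2]
    exact h1
  refine le_trans ?_ ((le_abs_self _).trans (abs_quad_le Z h))
  refine ge_of_tendsto h3 ((tendsto_wordsUpTo.eventually (eventually_ge_atTop s)).mono
    fun N hN => ?_)
  exact Finset.sum_le_sum_of_subset_of_nonneg hN fun α _ _ =>
    mul_nonneg (f.coeff_nonneg α) (by positivity)

lemma PhiBound.hasSum_quad (hb : PhiBound f X C) (Y : H →L[ℂ] H) (h : H) :
    HasSum (fun α => f.coeff α * quad Y (wordAdj X α h)) (quad (Phi f X Y) h) := by
  have := Complex.reCLM.hasSum ((hb.norm_phi_le_and_hasSum Y).2 h h)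
  simpa [quad, Function.comp_def] using this

lemma PhiBound.isSelfAdjoint_phi (hb : PhiBound f X C) {Y : H →L[ℂ] H} (hY : IsSelfAdjoint Y) :
    IsSelfAdjoint (Phi f X Y) := by
  rw [ContinuousLinearMap.isSelfAdjoint_iff'] at hY ⊢
  refine ContinuousLinearMap.ext fun h => ext_inner_left ℂ fun h' => ?_
  rw [ContinuousLinearMap.adjoint_inner_right]
  have h1 := (hb.norm_phi_le_and_hasSum Y).2 h h'
  have h2 := ((hb.norm_phi_le_and_hasSum Y).2 h' h).map (starRingEnd ℂ) Complex.continuous_conj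
  rw [inner_conj_symm] at h2
  refine h2.unique ?_
  convert! h1 using 2 with α
  rw [Function.comp_apply, map_mul, Complex.conj_ofReal, inner_conj_symm,
    ← ContinuousLinearMap.adjoint_inner_right, hY]

/-- `Φ_{f,X}` as a bounded operator on `B(H)`. -/
def phiCLM (hb : PhiBound f X C) : (H →L[ℂ] H) →L[ℂ] (H →L[ℂ] H) :=
  LinearMap.mkContinuous
    { toFun := Phi f X
      map_add' := fun Y Y' => by
        refine ContinuousLinearMap.ext fun h => ext_inner_left ℂ fun h' => ?_
        have h1 := (hb.norm_phi_le_and_hasSum Y).2 h h'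
        have h2 := (hb.norm_phi_le_and_hasSum Y').2 h h'
        refine ((hb.norm_phi_le_and_hasSum (Y + Y')).2 h h').unique ?_
        simpa [mul_add, inner_add_right] using h1.add h2
      map_smul' := fun c Y => by
        refine ContinuousLinearMap.ext fun h => ext_inner_left ℂ fun h' => ?_
        refine ((hb.norm_phi_le_and_hasSum (c • Y)).2 h h').unique ?_
        have h1 := ((hb.norm_phi_le_and_hasSum Y).2 h h').mul_left c
        simpa [inner_smul_right, mul_left_comm] using h1 }
    C fun Y => (hb.norm_phi_le_and_hasSum Y).1

@[simp] lemma phiCLM_apply (hb : PhiBound f X C) (Y : H →L[ℂ] H) : phiCLM hb Y = Phi f X Y := rfl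

lemma norm_phiCLM_le (hb : PhiBound f X C) : ‖phiCLM hb‖ ≤ C :=
  LinearMap.mkContinuous_norm_le _ hb.1 _

/-- The defect `(id - Φ_{f,X})^k (I)`. -/
def defect (f : PositiveRegular n) (X : Tuple n H) (k : ℕ) : H →L[ℂ] H :=
  (fun Y => Y - Phi f X Y)^[k] 1

@[simp] lemma defect_zero : defect f X 0 = 1 := rfl

lemma defect_succ (k : ℕ) : defect f X (k + 1) = defect f X k - Phi f X (defect f X k) := by
  rw [defect, Function.iterate_succ_apply']
  rfl

lemma PhiBound.defect_eq (hb : PhiBound f X C) (k : ℕ) :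
    defect f X k = ((1 - phiCLM hb) ^ k) 1 := by
  induction k with
  | zero => simp
  | succ k ih =>
    rw [defect_succ, pow_succ', mul_apply_eq_comp, ← ih]
    simp

lemma PhiBound.isSelfAdjoint_defect (hb : PhiBound f X C) (k : ℕ) :
    IsSelfAdjoint (defect f X k) := by
  induction k with
  | zero => exact IsSelfAdjoint.one _
  | succ k ih =>
    rw [defect_succ]
    exact ih.sub (hb.isSelfAdjoint_phi ih)

/-- Membership in the domain in terms of quadratic forms. -/
lemma mem_domain_iff {m : ℕ} : X ∈ domain f m H ↔ (∃ C, PhiBound f X C) ∧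
    ∀ k, 1 ≤ k → k ≤ m → ∀ h, 0 ≤ quad (defect f X k) h := by
  constructor
  · rintro ⟨hc, hp⟩
    exact ⟨hc.exists_phiBound, fun k h1 h2 h => quad_nonneg (hp k h1 h2) h⟩
  · rintro ⟨⟨C, hb⟩, hp⟩
    exact ⟨hb.phiConverges, fun k h1 h2 =>
      (isPositive_iff_quad (hb.isSelfAdjoint_defect k)).2 (hp k h1 h2)⟩

lemma phiBound_one_of_mem_domain {m : ℕ} (hm : 1 ≤ m) (hX : X ∈ domain f m H) :
    PhiBound f X 1 := by
  obtain ⟨⟨C, hb⟩, hp⟩ := mem_domain_iff.1 hX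
  refine ⟨zero_le_one, fun h s => ?_⟩
  have h1 := hp 1 le_rfl hm h
  rw [defect_succ, defect_zero, quad_sub, quad_one] at h1
  have h2 := hb.hasSum_quad 1 h
  simp only [quad_one] at h2
  have := sum_le_hasSum s (fun α _ => mul_nonneg (f.coeff_nonneg α) (by positivity)) h2
  linarith

lemma norm_le_of_mem_domain {m : ℕ} (hm : 1 ≤ m) (hX : X ∈ domain f m H) (i : Fin n) :
    ‖X i‖ ≤ √(1 / f.coeff [i]) := by
  have ha := f.coeff_letter_pos i
  rw [← LinearIsometryEquiv.norm_map ContinuousLinearMap.adjoint (X i)]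
  refine ContinuousLinearMap.opNorm_le_bound _ (Real.sqrt_nonneg _) fun h => ?_
  have h1 := (phiBound_one_of_mem_domain hm hX).2 h {[i]}
  rw [Finset.sum_singleton, wordAdj_cons, wordAdj_nil, one_mul, one_mul] at h1
  refine le_of_sq_le_sq ?_ (by positivity)
  rw [mul_pow, Real.sq_sqrt (by positivity), one_div, inv_mul_eq_div, le_div_iff₀ ha]
  linarith

lemma phi_smul_of_norm_one {z : ℂ} (hz : ‖z‖ = 1) : Phi f (z • X) = Phi f X ∧
    (PhiConverges f (z • X) ↔ PhiConverges f X) := by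
  have : phiPartial f (z • X) = phiPartial f X := by
    funext Y N
    rw [phiPartial_eq, phiPartial_eq]
    refine Finset.sum_congr rfl fun α _ => ?_
    have hz' : z ^ α.length * (starRingEnd ℂ z) ^ α.length = 1 := by
      rw [← mul_pow, Complex.mul_conj']
      simp [hz]
    rw [wordProd_smul, wordAdj_smul, smul_mul_assoc, smul_mul_assoc, mul_smul_comm,
      smul_smul (z ^ α.length), hz', one_smul]
  constructor
  · funext Y
    rw [Phi, Phi, this]
  · rw [PhiConverges, PhiConverges, this]

/-- The domains are circular. -/
lemma smul_mem_domain {m : ℕ} {z : ℂ} (hz : ‖z‖ = 1) (hX : X ∈ domain f m H) :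
    z • X ∈ domain f m H := by
  obtain ⟨h1, h2⟩ := phi_smul_of_norm_one (f := f) (X := X) hz
  refine ⟨h2.2 hX.1, ?_⟩
  rw [h1]
  exact hX.2

/-- A tuple for which `Φ_{f,X}` is small enough in norm belongs to the domain. -/
lemma exists_pos_phiBound_mem_domain (f : PositiveRegular n) (m : ℕ) :
    ∃ δ > 0, ∀ (X : Tuple n H), PhiBound f X δ → X ∈ domain f m H := by
  -- `‖(1 - A)^k - 1‖ ≤ (1 + ‖A‖)^k - 1`, and positivity of `(1 - A)^k I` needs this below `1`.
  have hev : ∀ᶠ x : ℝ in 𝓝 0, ∀ k ∈ Finset.range (m + 1), (1 + x) ^ k - 1 < 1 := by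
    rw [Filter.eventually_all_finset]
    intro k _
    have : Continuous fun x : ℝ => (1 + x) ^ k - 1 := by fun_prop
    exact this.tendsto' 0 0 (by simp) |>.eventually (gt_mem_nhds one_pos)
  obtain ⟨δ, hδ, hball⟩ := Metric.eventually_nhds_iff.1 hev
  refine ⟨δ / 2, by positivity, fun X hb => mem_domain_iff.2 ⟨⟨_, hb⟩, fun k _ hk h => ?_⟩⟩
  have hx := hball (y := δ / 2) (by simp [abs_of_pos hδ, hδ]) k (by simp; omega)
  have hA := norm_phiCLM_le hb
  have hpow : ∀ k, ‖(1 - phiCLM hb) ^ k - 1‖ ≤ (1 + δ / 2) ^ k - 1 := by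
    intro k
    induction k with
    | zero => simp
    | succ k ih =>
      have e : (1 - phiCLM hb) ^ (k + 1) - 1 =
          ((1 - phiCLM hb) ^ k - 1) - ((1 - phiCLM hb) ^ k - 1) * phiCLM hb - phiCLM hb := by
        rw [pow_succ, mul_sub, mul_one, sub_mul, one_mul]; abel
      rw [e]
      refine (norm_sub_le _ _).trans ?_
      have h1 := norm_sub_le ((1 - phiCLM hb) ^ k - 1) (((1 - phiCLM hb) ^ k - 1) * phiCLM hb)
      have h2 := norm_mul_le ((1 - phiCLM hb) ^ k - 1) (phiCLM hb)
      have h3 := mul_le_mul ih hA (norm_nonneg _) ((norm_nonneg _).trans ih)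
      rw [pow_succ]
      linarith
  have hd : ‖defect f X k - 1‖ ≤ 1 := by
    rw [hb.defect_eq]
    have h1 := ((1 - phiCLM hb) ^ k - 1).le_opNorm 1
    have h2 : ‖(1 : H →L[ℂ] H)‖ ≤ 1 := ContinuousLinearMap.norm_id_le
    have h3 := mul_le_mul (hpow k) h2 (norm_nonneg _) ((norm_nonneg _).trans (hpow k))
    have h4 : ((1 - phiCLM hb) ^ k - 1) 1 = ((1 - phiCLM hb) ^ k) 1 - 1 := rfl
    rw [h4] at h1
    linarith
  have h1 := neg_abs_le (quad (defect f X k - 1) h)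
  have h2 := abs_quad_le (defect f X k - 1) h
  rw [quad_sub, quad_one] at h1 h2
  have h3 := mul_le_mul_of_nonneg_right hd (sq_nonneg ‖h‖)
  linarith

end Phi

/-! ### Rearrangement of nonnegative double series -/

section Sums

/-- Tonelli's theorem for nonnegative double families. -/
lemma hasSum_swap {ι κ : Type*} {g : ι → κ → ℝ} (h0 : ∀ i k, 0 ≤ g i k) {s : ι → ℝ} {S : ℝ}
    (h1 : ∀ i, HasSum (g i) (s i)) (h2 : HasSum s S) :
    (∀ k, Summable fun i => g i k) ∧ HasSum (fun k => ∑' i, g i k) S := by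
  have hs : Summable fun p : ι × κ => g p.1 p.2 :=
    (summable_prod_of_nonneg fun p => h0 p.1 p.2).2
      ⟨fun i => (h1 i).summable, by simpa only [(h1 _).tsum_eq] using h2.summable⟩
  have hS : HasSum (fun p : ι × κ => g p.1 p.2) S := by
    have := hs.hasSum
    rwa [(this.prod_fiberwise h1).unique h2] at this
  have hS' : HasSum (fun p : κ × ι => g p.2 p.1) S := (Equiv.prodComm κ ι).hasSum_iff.2 hS
  have hk := fun k => hS'.summable.prod_factor k
  exact ⟨hk, hS'.prod_fiberwise fun k => (hk k).hasSum⟩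

variable {n : ℕ}

/-- A word together with a place to cut it is a pair of words. -/
def splitEquiv (n : ℕ) : (Σ γ : Word n, Fin (γ.length + 1)) ≃ Word n × Word n where
  toFun p := (p.1.take p.2, p.1.drop p.2)
  invFun p := ⟨p.1 ++ p.2, ⟨p.1.length, by simp⟩⟩
  left_inv := by
    rintro ⟨γ, k, hk⟩
    have h1 : γ.take k ++ γ.drop k = γ := List.take_append_drop k γ
    have h2 : (γ.take k).length = k := by simp; omega
    refine Sigma.ext h1 ?_
    rw [Fin.heq_ext_iff (by simp only [h1])]
    exact h2
  right_inv := by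
    rintro ⟨α, β⟩
    simp

variable {F : Word n → Word n → ℝ}

/-- A double series over pairs of words, summed along the factorizations of each word. -/
lemma hasSum_split (h0 : ∀ α β, 0 ≤ F α β) {s : Word n → ℝ} {S : ℝ}
    (h1 : ∀ α, HasSum (F α) (s α)) (h2 : HasSum s S) :
    HasSum (fun γ : Word n => ∑ k ∈ Finset.range (γ.length + 1), F (γ.take k) (γ.drop k)) S := by
  have hs : Summable fun p : Word n × Word n => F p.1 p.2 :=
    (summable_prod_of_nonneg fun p => h0 p.1 p.2).2
      ⟨fun i => (h1 i).summable, by simpa only [(h1 _).tsum_eq] using h2.summable⟩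
  have hS : HasSum (fun p : Word n × Word n => F p.1 p.2) S := by
    have := hs.hasSum
    rwa [(this.prod_fiberwise h1).unique h2] at this
  have h3 := ((splitEquiv n).hasSum_iff.2 hS).sigma fun γ => hasSum_fintype _
  convert! h3 using 2 with γ
  rw [Finset.sum_range]
  rfl

lemma exists_hasSum_of_split (h0 : ∀ α β, 0 ≤ F α β) {S : ℝ}
    (h : HasSum (fun γ : Word n => ∑ k ∈ Finset.range (γ.length + 1), F (γ.take k) (γ.drop k)) S) :
    ∃ s : Word n → ℝ, (∀ α, HasSum (F α) (s α)) ∧ HasSum s S := by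
  have h' : Summable fun p : (Σ γ : Word n, Fin (γ.length + 1)) =>
      F (splitEquiv n p).1 (splitEquiv n p).2 := by
    refine (summable_sigma_of_nonneg fun p => h0 _ _).2 ⟨fun γ => (hasSum_fintype _).summable, ?_⟩
    convert! h.summable using 2 with γ
    rw [tsum_fintype, Finset.sum_range]
    rfl
  have hs : Summable fun p : Word n × Word n => F p.1 p.2 := (splitEquiv n).summable_iff.1 h'
  have hα := fun α => (hs.prod_factor α).hasSum
  have h1 := hs.hasSum.prod_fiberwise hα
  have h2 := hasSum_split h0 hα h1
  rw [h2.unique h] at h1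
  exact ⟨_, hα, h1⟩

end Sums

/-! ### Compressions to coinvariant subspaces -/

section Kernel

variable {q : ℕ} {H : Type u} [NormedAddCommGroup H] [InnerProductSpace ℂ H] [CompleteSpace H]
  {L : Type v} [NormedAddCommGroup L] [InnerProductSpace ℂ L] [CompleteSpace L]
  {ι : Type*}

/-- The components `K_i : H → L` of an isometry from `H` to a multiple of `L` that intertwines
the adjoints of `X` with the (inflated) adjoints of `W`. Thus `X` is, up to unitary equivalence,
the compression of a multiple of `W` to a coinvariant subspace. -/
structure IsKernelFamily (K : ι → H →L[ℂ] L) (X : Tuple q H) (W : Tuple q L) : Prop where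
  hasSum_norm_sq : ∀ h, HasSum (fun i => ‖K i h‖ ^ 2) (‖h‖ ^ 2)
  intertwine : ∀ i j h, K i (ContinuousLinearMap.adjoint (X j) h) =
    ContinuousLinearMap.adjoint (W j) (K i h)

variable {K : ι → H →L[ℂ] L} {X : Tuple q H} {W : Tuple q L}

lemma IsKernelFamily.apply_wordAdj (hK : IsKernelFamily K X W) (i : ι) (α : Word q) (h : H) :
    K i (wordAdj X α h) = wordAdj W α (K i h) := by
  induction α generalizing h with
  | nil => simp
  | cons j α ih =>
    rw [wordAdj_cons, wordAdj_cons, mul_apply_eq_comp, mul_apply_eq_comp, ih, hK.intertwine]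

lemma IsKernelFamily.rowMul_rowMul {p : ℕ} (hK : IsKernelFamily K X W)
    (U : Matrix (Fin q) (Fin p) ℂ) :
    IsKernelFamily K (rowMul X U) (rowMul W U) := by
  refine ⟨hK.hasSum_norm_sq, fun i j h => ?_⟩
  simp only [rowMul, map_sum, map_smulₛₗ, sum_apply, smul_apply, hK.intertwine,
    RingHom.id_apply]

variable {g : PositiveRegular q} {C : ℝ}

lemma IsKernelFamily.summable_prod (hK : IsKernelFamily K X W) (hb : PhiBound g W C) (h : H) :
    Summable fun p : ι × Word q => g.coeff p.2 * ‖wordAdj W p.2 (K p.1 h)‖ ^ 2 := by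
  have h0 : ∀ i α, 0 ≤ g.coeff α * ‖wordAdj W α (K i h)‖ ^ 2 :=
    fun i α => mul_nonneg (g.coeff_nonneg _) (by positivity)
  have h1 : Summable fun i => ∑' α, g.coeff α * ‖wordAdj W α (K i h)‖ ^ 2 :=
    Summable.of_nonneg_of_le (fun i => tsum_nonneg (h0 i))
      (fun i => Real.tsum_le_of_sum_le (h0 i) (hb.2 (K i h)))
      ((hK.hasSum_norm_sq h).summable.mul_left C)
  have h2 : 0 ≤ fun p : ι × Word q => g.coeff p.2 * ‖wordAdj W p.2 (K p.1 h)‖ ^ 2 :=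
    fun p => h0 p.1 p.2
  have h3 : ∀ i, Summable fun α => g.coeff α * ‖wordAdj W α (K i h)‖ ^ 2 :=
    fun i => hb.summable (K i h)
  rw [summable_prod_of_nonneg h2]
  exact ⟨h3, h1⟩

lemma IsKernelFamily.phiBound (hK : IsKernelFamily K X W) (hb : PhiBound g W C) :
    PhiBound g X C := by
  refine ⟨hb.1, fun h s => ?_⟩
  have h1 : HasSum (fun i => ∑ α ∈ s, g.coeff α * ‖wordAdj W α (K i h)‖ ^ 2)
      (∑ α ∈ s, g.coeff α * ‖wordAdj X α h‖ ^ 2) :=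
    hasSum_sum fun α _ => by
      simpa only [hK.apply_wordAdj] using (hK.hasSum_norm_sq (wordAdj X α h)).mul_left _
  exact hasSum_le (fun i => hb.2 (K i h) s) h1 ((hK.hasSum_norm_sq h).mul_left C)

/-- The Poisson transform `Z ↦ ∑ K_i^* Z K_i` intertwines `Φ_{g,W}` and `Φ_{g,X}`. -/
lemma IsKernelFamily.hasSum_quad_phi (hK : IsKernelFamily K X W) (hb : PhiBound g W C)
    {Y : H →L[ℂ] H} {Z : L →L[ℂ] L} (hYZ : ∀ h, HasSum (fun i => quad Z (K i h)) (quad Y h))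
    (h : H) : HasSum (fun i => quad (Phi g W Z) (K i h)) (quad (Phi g X Y) h) := by
  have hs : Summable fun p : ι × Word q =>
      g.coeff p.2 * quad Z (wordAdj W p.2 (K p.1 h)) := by
    refine Summable.of_norm_bounded ((hK.summable_prod hb h).mul_left ‖Z‖) fun p => ?_
    rw [norm_mul, Real.norm_of_nonneg (g.coeff_nonneg _), mul_left_comm]
    exact mul_le_mul_of_nonneg_left (abs_quad_le _ _) (g.coeff_nonneg _)
  have h1 := hs.hasSum.prod_fiberwise fun i => hb.hasSum_quad Z (K i h)
  have h2 := ((Equiv.prodComm (Word q) ι).hasSum_iff.2 hs.hasSum).prod_fiberwise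
    (g := fun α => g.coeff α * quad Y (wordAdj X α h)) fun α => by
      have := (hYZ (wordAdj X α h)).mul_left (g.coeff α)
      simp only [hK.apply_wordAdj] at this
      exact this
  rw [((hK.phiBound hb).hasSum_quad Y h).unique h2]
  exact h1

lemma IsKernelFamily.mem_domain (hK : IsKernelFamily K X W) {l : ℕ} (hW : W ∈ domain g l L) :
    X ∈ domain g l H := by
  obtain ⟨⟨C, hb⟩, hp⟩ := mem_domain_iff.1 hW
  have hd : ∀ k h, HasSum (fun i => quad (defect g W k) (K i h)) (quad (defect g X k) h) := by
    intro k
    induction k with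
    | zero => simpa only [defect_zero, quad_one] using hK.hasSum_norm_sq
    | succ k ih =>
      intro h
      simp only [defect_succ, quad_sub]
      exact (ih h).sub (hK.hasSum_quad_phi hb ih h)
  exact mem_domain_iff.2 ⟨⟨C, hK.phiBound hb⟩, fun k h1 h2 h =>
    (hd k h).nonneg fun i => hp k h1 h2 _⟩

lemma isKernelFamily_of_unitary (J : H ≃ₗᵢ[ℂ] L)
    (hX : ∀ j h, J (ContinuousLinearMap.adjoint (X j) h) =
      ContinuousLinearMap.adjoint (W j) (J h)) :
    IsKernelFamily (fun _ : Unit => (J.toContinuousLinearEquiv : H →L[ℂ] L)) X W :=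
  ⟨fun h => by simp, fun _ j h => hX j h⟩

end Kernel

/-! ### The coefficients of `(1 - f)^{-m}` -/

section Coefficients

variable {n : ℕ} (f : PositiveRegular n)

/-- The coefficients of the product `f · G` of formal power series. -/
def coeffConv (G : Word n → ℝ) (γ : Word n) : ℝ :=
  ∑ k ∈ Finset.range (γ.length + 1), f.coeff (γ.take k) * G (γ.drop k)

lemma coeffConv_nonneg {G : Word n → ℝ} (hG : ∀ α, 0 ≤ G α) (γ : Word n) :
    0 ≤ coeffConv f G γ :=
  Finset.sum_nonneg fun _ _ => mul_nonneg (f.coeff_nonneg _) (hG _)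

lemma factorSum_succ (j : ℕ) (γ : Word n) :
    factorSum f (j + 1) γ = coeffConv f (factorSum f j) γ := by
  rw [factorSum, coeffConv, Finset.sum_range_succ']
  simp [f.coeff_nil]

lemma factorSum_eq_zero {j : ℕ} {γ : Word n} (h : γ.length < j) : factorSum f j γ = 0 := by
  induction j generalizing γ with
  | zero => omega
  | succ j ih =>
    refine Finset.sum_eq_zero fun k hk => ?_
    rw [ih, mul_zero]
    rw [Finset.mem_range] at hk
    rw [List.length_drop]
    omega

/-- The coefficients of `(1 - f)^{-m} = ∑_j multichoose(m, j) f^j`; unlike `bCoeff`, this is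
meaningful also for `m = 0`. -/
def invCoeff (m : ℕ) (γ : Word n) : ℝ :=
  ∑ j ∈ Finset.range (γ.length + 1), (m.multichoose j : ℝ) * factorSum f j γ

lemma invCoeff_nonneg (m : ℕ) (γ : Word n) : 0 ≤ invCoeff f m γ :=
  Finset.sum_nonneg fun _ _ => mul_nonneg (Nat.cast_nonneg _) (factorSum_nonneg f _ _)

lemma invCoeff_eq_sum (m : ℕ) {γ : Word n} {N : ℕ} (hN : γ.length < N) :
    invCoeff f m γ = ∑ j ∈ Finset.range N, (m.multichoose j : ℝ) * factorSum f j γ := by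
  refine Finset.sum_subset (Finset.range_subset_range.2 hN) fun j _ hj => ?_
  rw [factorSum_eq_zero f (by simpa using hj), mul_zero]

/-- `(1 - f) · (1 - f)^{-(m + 1)} = (1 - f)^{-m}`. -/
lemma invCoeff_succ (m : ℕ) (γ : Word n) :
    invCoeff f (m + 1) γ = invCoeff f m γ + coeffConv f (invCoeff f (m + 1)) γ := by
  have h1 : coeffConv f (invCoeff f (m + 1)) γ = ∑ j ∈ Finset.range (γ.length + 1),
      ((m + 1).multichoose j : ℝ) * factorSum f (j + 1) γ := by
    simp only [factorSum_succ, coeffConv, Finset.mul_sum]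
    rw [Finset.sum_comm]
    refine Finset.sum_congr rfl fun k _ => ?_
    rw [invCoeff_eq_sum f (m + 1) (N := γ.length + 1) (by simp), Finset.mul_sum]
    exact Finset.sum_congr rfl fun j _ => by ring
  rw [h1, invCoeff_eq_sum f (m + 1) (N := γ.length + 1 + 1) (by omega),
    invCoeff_eq_sum f m (N := γ.length + 1 + 1) (by omega), Finset.sum_range_succ',
    Finset.sum_range_succ' (fun j => (m.multichoose j : ℝ) * factorSum f j γ),
    add_right_comm, ← Finset.sum_add_distrib]
  simp only [Nat.multichoose_zero_right]
  congr 1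
  refine Finset.sum_congr rfl fun j _ => ?_
  rw [Nat.multichoose_succ_succ]
  push_cast
  ring

lemma multichoose_eq_choose {m : ℕ} (hm : 1 ≤ m) (j : ℕ) :
    m.multichoose j = (j + m - 1).choose (m - 1) := by
  rw [Nat.multichoose_eq, add_comm, ← Nat.choose_symm_of_eq_add]
  omega

lemma bCoeff_eq_invCoeff {m : ℕ} (hm : 1 ≤ m) (γ : Word n) :
    bCoeff f m γ = invCoeff f m γ := by
  rw [bCoeff, invCoeff]
  split_ifs with h
  · subst h
    simp [factorSum]
  · rw [Finset.sum_range_succ', factorSum, if_neg h, mul_zero, add_zero,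
      Finset.range_eq_Ico, Finset.sum_Ico_add' (fun j => (m.multichoose j : ℝ) * factorSum f j γ)]
    refine Finset.sum_congr rfl fun j _ => ?_
    rw [multichoose_eq_choose hm, mul_comm]

lemma bCoeff_pos (m : ℕ) (γ : Word n) : 0 < bCoeff f m γ := by
  induction γ with
  | nil => simp [bCoeff]
  | cons i γ ih => exact (mul_pos (f.coeff_letter_pos i) ih).trans_le (bCoeff_cons_ge f m i γ)

end Coefficients

/-! ### The universal model belongs to its domain -/

section Model

variable {n : ℕ} (f : PositiveRegular n) (m : ℕ)

lemma adjoint_model_apply (i : Fin n) (x : Fock n) (β : Word n) :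
    ContinuousLinearMap.adjoint (model f m i) x β = (modelWeight f m i β : ℂ) * x (i :: β) := by
  have h : ∀ (γ : Word n) (y : Fock n), ⟪fockBasis γ, y⟫_ℂ = y γ := fun γ y => by
    rw [fockBasis, lp.inner_single_left]
    simp
  rw [← h, ContinuousLinearMap.adjoint_inner_right, model_apply_fockBasis, inner_smul_left, h,
    Complex.conj_ofReal]
  rfl

lemma wordAdj_model_apply (α : Word n) (x : Fock n) (β : Word n) :
    wordAdj (model f m) α x β = (√(bCoeff f m β / bCoeff f m (α ++ β)) : ℂ) * x (α ++ β) := by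
  induction α generalizing x with
  | nil => simp [(bCoeff_pos f m β).ne']
  | cons i α ih =>
    rw [wordAdj_cons, mul_apply_eq_comp, ih, adjoint_model_apply, ← mul_assoc,
      ← Complex.ofReal_mul, modelWeight, ← Real.sqrt_mul (div_nonneg (bCoeff_nonneg _ _ _)
        (bCoeff_nonneg _ _ _)), div_mul_div_cancel₀ (bCoeff_pos f m _).ne']
    rfl

lemma norm_wordAdj_model_apply_sq (α : Word n) (x : Fock n) (β : Word n) :
    ‖wordAdj (model f m) α x β‖ ^ 2 =
      bCoeff f m β / bCoeff f m (α ++ β) * ‖x (α ++ β)‖ ^ 2 := by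
  rw [wordAdj_model_apply, norm_mul, mul_pow, Complex.norm_real, Real.norm_eq_abs, sq_abs,
    Real.sq_sqrt (div_nonneg (bCoeff_nonneg _ _ _) (bCoeff_nonneg _ _ _))]

lemma hasSum_norm_sq_fock (x : Fock n) : HasSum (fun γ => ‖x γ‖ ^ 2) (‖x‖ ^ 2) := by
  simpa using lp.hasSum_norm (p := 2) (by norm_num) x

/-- `∑_{αβ = γ} a_α b_β ≤ b_γ`. -/
lemma coeffConv_bCoeff_le {m : ℕ} (hm : 1 ≤ m) (γ : Word n) :
    coeffConv f (bCoeff f m) γ ≤ bCoeff f m γ := by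
  obtain ⟨k, rfl⟩ := Nat.exists_eq_add_of_le' hm
  have h := invCoeff_succ f k γ
  rw [show bCoeff f (k + 1) = invCoeff f (k + 1) from funext (bCoeff_eq_invCoeff f hm)]
  linarith [invCoeff_nonneg f k γ]

lemma sum_split_weight (d : Word n → ℝ) (x : Fock n) (γ : Word n) :
    ∑ k ∈ Finset.range (γ.length + 1), f.coeff (γ.take k) *
        (d (γ.drop k) / bCoeff f m (γ.take k ++ γ.drop k) * ‖x (γ.take k ++ γ.drop k)‖ ^ 2) =
      coeffConv f d γ / bCoeff f m γ * ‖x γ‖ ^ 2 := by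
  simp only [List.take_append_drop]
  rw [coeffConv, Finset.sum_div, Finset.sum_mul]
  exact Finset.sum_congr rfl fun k _ => by ring

lemma phiBound_model {m : ℕ} (hm : 1 ≤ m) : PhiBound f (model f m) 1 := by
  refine ⟨zero_le_one, fun x s => ?_⟩
  have hle : ∀ γ, coeffConv f (bCoeff f m) γ / bCoeff f m γ * ‖x γ‖ ^ 2 ≤ ‖x γ‖ ^ 2 := fun γ =>
    mul_le_of_le_one_left (by positivity)
      ((div_le_one (bCoeff_pos f m γ)).2 (coeffConv_bCoeff_le f hm γ))
  have h0 : ∀ γ, 0 ≤ coeffConv f (bCoeff f m) γ / bCoeff f m γ * ‖x γ‖ ^ 2 := fun γ =>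
    mul_nonneg (div_nonneg (coeffConv_nonneg f (bCoeff_nonneg f m) γ) (bCoeff_nonneg f m γ))
      (by positivity)
  have hx := hasSum_norm_sq_fock x
  have hS := (Summable.of_nonneg_of_le h0 hle hx.summable).hasSum
  simp only [← sum_split_weight] at hS
  obtain ⟨t, ht, hts⟩ := exists_hasSum_of_split (F := fun α β => f.coeff α *
    (bCoeff f m β / bCoeff f m (α ++ β) * ‖x (α ++ β)‖ ^ 2))
    (fun α β => mul_nonneg (f.coeff_nonneg α) (mul_nonneg (div_nonneg (bCoeff_nonneg _ _ _)
      (bCoeff_nonneg _ _ _)) (by positivity))) hS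
  have hteq : ∀ α, f.coeff α * ‖wordAdj (model f m) α x‖ ^ 2 = t α := fun α => by
    have h1 := (hasSum_norm_sq_fock (wordAdj (model f m) α x)).mul_left (f.coeff α)
    simp only [norm_wordAdj_model_apply_sq] at h1
    exact h1.unique (ht α)
  simp only [hteq]
  refine (sum_le_hasSum s (fun α _ => ?_) hts).trans ?_
  · rw [← hteq]
    exact mul_nonneg (f.coeff_nonneg α) (by positivity)
  · rw [one_mul]
    simp only [sum_split_weight]
    exact hasSum_le hle (Summable.of_nonneg_of_le h0 hle hx.summable).hasSum hx

/-- `Φ_{f,W}` acts on the diagonal operator with entries `d_γ / b_γ` as multiplication of the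
series `∑ d_γ Z_γ` by `f`. -/
lemma hasSum_quad_phi_model {m : ℕ} (hm : 1 ≤ m) {D : Fock n →L[ℂ] Fock n} {d : Word n → ℝ}
    (hd : ∀ γ, 0 ≤ d γ)
    (hD : ∀ x, HasSum (fun γ => d γ / bCoeff f m γ * ‖x γ‖ ^ 2) (quad D x)) (x : Fock n) :
    HasSum (fun γ => coeffConv f d γ / bCoeff f m γ * ‖x γ‖ ^ 2)
      (quad (Phi f (model f m) D) x) := by
  simp only [← sum_split_weight]
  refine hasSum_split (F := fun α β => f.coeff α *
    (d β / bCoeff f m (α ++ β) * ‖x (α ++ β)‖ ^ 2))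
    (fun α β => mul_nonneg (f.coeff_nonneg α) (mul_nonneg (div_nonneg (hd _)
      (bCoeff_nonneg _ _ _)) (by positivity))) (fun α => ?_)
    ((phiBound_model f hm).hasSum_quad D x)
  have h1 := (hD (wordAdj (model f m) α x)).mul_left (f.coeff α)
  simp only [norm_wordAdj_model_apply_sq, ← mul_assoc _ (_ / _) (_ ^ 2),
    div_mul_div_cancel₀ (bCoeff_pos f m _).ne'] at h1
  simpa only [mul_assoc] using h1

lemma hasSum_quad_defect_model {m : ℕ} (hm : 1 ≤ m) {k : ℕ} (hk : k ≤ m) (x : Fock n) :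
    HasSum (fun γ => invCoeff f (m - k) γ / bCoeff f m γ * ‖x γ‖ ^ 2)
      (quad (defect f (model f m) k) x) := by
  induction k generalizing x with
  | zero =>
    rw [defect_zero, quad_one]
    convert! hasSum_norm_sq_fock x using 2 with γ
    rw [Nat.sub_zero, ← bCoeff_eq_invCoeff f hm, div_self (bCoeff_pos f m γ).ne', one_mul]
  | succ k ih =>
    rw [defect_succ, quad_sub]
    have h1 := hasSum_quad_phi_model f hm (invCoeff_nonneg f (m - k)) (ih (by omega)) x
    convert! (ih (by omega) x).sub h1 using 2 with γ
    rw [show m - k = m - (k + 1) + 1 by omega, invCoeff_succ]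
    ring

theorem model_mem_domain {m : ℕ} (hm : 1 ≤ m) : model f m ∈ domain f m (Fock n) :=
  mem_domain_iff.2 ⟨⟨1, phiBound_model f hm⟩, fun _ _ hk x =>
    (hasSum_quad_defect_model f hm hk x).nonneg fun γ => mul_nonneg
      (div_nonneg (invCoeff_nonneg f _ _) (bCoeff_nonneg f m γ)) (by positivity)⟩

end Model

/-! ### The Poisson kernel -/

section Poisson

variable {n : ℕ} {f : PositiveRegular n} {H : Type u} [NormedAddCommGroup H]
  [InnerProductSpace ℂ H] [CompleteSpace H] {T : Tuple n H} {C : ℝ}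

/-- `Φ^p(Y) = ∑_α (f^p)_α T_α Y T_α^*` for `Y ≥ 0`, as quadratic forms. -/
lemma PhiBound.hasSum_quad_pow (hb : PhiBound f T C) {Y : H →L[ℂ] H} (hY : ∀ h, 0 ≤ quad Y h)
    (p : ℕ) (h : H) :
    HasSum (fun α => factorSum f p α * quad Y (wordAdj T α h)) (quad ((phiCLM hb ^ p) Y) h) := by
  induction p generalizing h with
  | zero =>
    have := hasSum_single (f := fun α => factorSum f 0 α * quad Y (wordAdj T α h)) []
      (fun α hα => by simp [factorSum, hα])
    simpa [factorSum] using this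
  | succ p ih =>
    rw [pow_succ', mul_apply_eq_comp, phiCLM_apply]
    have h1 := hasSum_split (F := fun α β => f.coeff α *
      (factorSum f p β * quad Y (wordAdj T (α ++ β) h)))
      (fun α β => mul_nonneg (f.coeff_nonneg α) (mul_nonneg (factorSum_nonneg f p β) (hY _)))
      (fun α => by
        have := (ih (wordAdj T α h)).mul_left (f.coeff α)
        simpa only [wordAdj_append, mul_apply_eq_comp] using this)
      (hb.hasSum_quad _ h)
    convert! h1 using 2 with γ
    rw [factorSum_succ, coeffConv, Finset.sum_mul]
    refine Finset.sum_congr rfl fun k _ => ?_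
    rw [List.take_append_drop, mul_assoc]

/-- The Neumann series `I = ∑_p binom(p + m - 1, m - 1) Φ^p(Δ)` for the defect
`Δ = (id - Φ)^m (I)`. -/
lemma PhiBound.hasSum_quad_neumann (hb : PhiBound f T C) (hC : C < 1) (m : ℕ) (h : H) :
    HasSum (fun p => ((p + m).choose m : ℝ) *
      quad ((phiCLM hb ^ p) (defect f T (m + 1))) h) (‖h‖ ^ 2) := by
  have hA : ‖phiCLM hb‖ < 1 := (norm_phiCLM_le hb).trans_lt hC
  have h1 := hasSum_choose_mul_geometric_of_norm_lt_one' m hA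
  have h2 := (ContinuousLinearMap.apply ℂ (H →L[ℂ] H) (defect f T (m + 1))).hasSum h1
  have hunit : IsUnit ((1 - phiCLM hb) ^ (m + 1)) :=
    (isUnit_one_sub_of_norm_lt_one hA).pow _
  have h3 : (ContinuousLinearMap.apply ℂ (H →L[ℂ] H) (defect f T (m + 1)))
      (Ring.inverse (1 - phiCLM hb) ^ (m + 1)) = 1 := by
    rw [ContinuousLinearMap.apply_apply, hb.defect_eq, Ring.inverse_pow, ← mul_apply_eq_comp,
      Ring.inverse_mul_cancel _ hunit]
    rfl
  rw [h3] at h2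
  have h4 := Complex.reCLM.hasSum
    (((innerSL ℂ h).comp (ContinuousLinearMap.apply ℂ H h)).hasSum h2)
  have h5 : Complex.reCLM (((innerSL ℂ h).comp (ContinuousLinearMap.apply ℂ H h)) 1) =
      ‖h‖ ^ 2 := quad_one h
  rw [h5] at h4
  convert! h4 using 2 with p
  simp only [ContinuousLinearMap.apply_apply, ContinuousLinearMap.comp_apply,
    innerSL_apply_apply, Complex.reCLM_apply]
  rw [← nsmul_eq_mul _ (phiCLM hb ^ p), ← Nat.cast_smul_eq_nsmul ℂ]
  simp [quad, inner_smul_right]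

/-- The reproducing identity `∑_α b_α T_α Δ T_α^* = I` of a pure tuple, as quadratic forms. -/
lemma PhiBound.hasSum_bCoeff_quad (hb : PhiBound f T C) (hC : C < 1) {m : ℕ} (hm : 1 ≤ m)
    (hΔ : ∀ h, 0 ≤ quad (defect f T m) h) (h : H) :
    HasSum (fun α => bCoeff f m α * quad (defect f T m) (wordAdj T α h)) (‖h‖ ^ 2) := by
  obtain ⟨m, rfl⟩ := Nat.exists_eq_add_of_le' hm
  have h1 := hb.hasSum_quad_neumann hC m h
  have h2 := (hasSum_swap (g := fun p α => ((p + m).choose m : ℝ) *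
    (factorSum f p α * quad (defect f T (m + 1)) (wordAdj T α h)))
    (fun p α => mul_nonneg (Nat.cast_nonneg _) (mul_nonneg (factorSum_nonneg f p α) (hΔ _)))
    (fun p => (hb.hasSum_quad_pow hΔ p h).mul_left _) h1).2
  convert! h2 using 2 with α
  rw [tsum_eq_sum (s := Finset.range (α.length + 1)) fun p hp => by
    rw [factorSum_eq_zero f (by simpa using hp), zero_mul, mul_zero],
    bCoeff_eq_invCoeff f hm, invCoeff, Finset.sum_mul]
  refine Finset.sum_congr rfl fun p _ => ?_
  rw [multichoose_eq_choose hm, mul_assoc]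
  rfl

/-- The Poisson kernel of a tuple `T` in the domain with `‖Φ_{f,T}‖ < 1`: its components with
respect to an orthonormal basis of `H` intertwine `T^*` and the adjoint of the universal model. -/
theorem exists_poissonKernel {m : ℕ} (hm : 1 ≤ m) (hT : T ∈ domain f m H)
    (hb : PhiBound f T C) (hC : C < 1) :
    ∃ (ι : Type u) (K : ι → H →L[ℂ] Fock n), IsKernelFamily K T (model f m) := by
  have hpos : (defect f T m).IsPositive := hT.2 m hm le_rfl
  obtain ⟨S, hS⟩ := CStarAlgebra.nonneg_iff_eq_star_mul_self.1
    ((ContinuousLinearMap.nonneg_iff_isPositive _).2 hpos)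
  have hquad : ∀ v, quad (defect f T m) v = ‖S v‖ ^ 2 := fun v => by
    rw [hS, quad, mul_apply_eq_comp, ContinuousLinearMap.star_eq_adjoint,
      ContinuousLinearMap.adjoint_inner_right, ← quad_one, quad]
    rfl
  obtain ⟨w, e, -⟩ := exists_hilbertBasis ℂ H
  have hpars : ∀ v, HasSum (fun i => ‖⟪e i, v⟫_ℂ‖ ^ 2) (‖v‖ ^ 2) := fun v => by
    have := Complex.reCLM.hasSum (e.hasSum_inner_mul_inner v v)
    rw [show Complex.reCLM ⟪v, v⟫_ℂ = ‖v‖ ^ 2 from quad_one v] at this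
    convert! this using 2 with i
    rw [← inner_conj_symm v (e i), Complex.conj_mul', Complex.reCLM_apply]
    norm_cast
  have hsum : ∀ h, HasSum (fun α => bCoeff f m α * ‖S (wordAdj T α h)‖ ^ 2) (‖h‖ ^ 2) :=
    fun h => by
      simpa only [hquad] using hb.hasSum_bCoeff_quad hC hm (fun h => quad_nonneg hpos h) h
  let A : w → Word n → H →L[ℂ] ℂ := fun i α =>
    (√(bCoeff f m α) : ℂ) • (innerSL ℂ (e i)).comp (S * wordAdj T α)
  have hA : ∀ i α h, A i α h = (√(bCoeff f m α) : ℂ) * ⟪e i, S (wordAdj T α h)⟫_ℂ :=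
    fun i α h => rfl
  have hAsq : ∀ i α h, ‖A i α h‖ ^ 2 = bCoeff f m α * ‖⟪e i, S (wordAdj T α h)⟫_ℂ‖ ^ 2 :=
    fun i α h => by
      rw [hA, norm_mul, mul_pow, Complex.norm_real, Real.norm_eq_abs, sq_abs,
        Real.sq_sqrt (bCoeff_nonneg f m α)]
  have hbd : ∀ i h (s : Finset (Word n)), ∑ α ∈ s, ‖A i α h‖ ^ 2 ≤ 1 ^ 2 * ‖h‖ ^ 2 := by
    intro i h s
    rw [one_pow, one_mul]
    refine le_trans (Finset.sum_le_sum fun α _ => ?_) (sum_le_hasSum s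
      (fun α _ => mul_nonneg (bCoeff_nonneg f m α) (by positivity)) (hsum h))
    rw [hAsq]
    refine mul_le_mul_of_nonneg_left (pow_le_pow_left₀ (norm_nonneg _) ?_ 2)
      (bCoeff_nonneg f m α)
    simpa [e.orthonormal.1 i] using norm_inner_le_norm (𝕜 := ℂ) (e i) (S (wordAdj T α h))
  refine ⟨w, fun i => column (A i) 1 zero_le_one (hbd i), fun h => ?_, fun i j h => ?_⟩
  · have h1 := (hasSum_swap (g := fun α i => bCoeff f m α * ‖⟪e i, S (wordAdj T α h)⟫_ℂ‖ ^ 2)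
      (fun α i => mul_nonneg (bCoeff_nonneg f m α) (by positivity))
      (fun α => (hpars _).mul_left _) (hsum h)).2
    convert! h1 using 2 with i
    rw [← (hasSum_norm_sq_fock _).tsum_eq]
    exact tsum_congr fun α => hAsq i α h
  · ext α
    rw [adjoint_model_apply, column_apply, column_apply, hA, hA, wordAdj_cons,
      mul_apply_eq_comp, ← mul_assoc, ← Complex.ofReal_mul, modelWeight,
      ← Real.sqrt_mul (div_nonneg (bCoeff_nonneg _ _ _) (bCoeff_nonneg _ _ _)),
      div_mul_cancel₀ _ (bCoeff_pos f m _).ne']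

lemma phiBound_smul {X : Tuple n H} (hb : PhiBound f X C) {r : ℝ} (h0 : 0 ≤ r) (h1 : r ≤ 1) :
    PhiBound f ((r : ℂ) • X) (r ^ 2 * C) := by
  refine ⟨mul_nonneg (sq_nonneg r) hb.1, fun h s => ?_⟩
  have h2 := mul_le_mul_of_nonneg_left (hb.2 h s) (sq_nonneg r)
  rw [Finset.mul_sum, ← mul_assoc] at h2
  refine le_trans (Finset.sum_le_sum fun α _ => ?_) h2
  rw [wordAdj_smul, smul_apply, norm_smul, mul_pow, mul_left_comm (f.coeff α)]
  rcases eq_or_ne α [] with rfl | hα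
  · simp [f.coeff_nil]
  · refine mul_le_mul_of_nonneg_right ?_ (mul_nonneg (f.coeff_nonneg α) (by positivity))
    have hlen : 1 ≤ α.length := List.length_pos_of_ne_nil hα
    rw [Complex.conj_ofReal, norm_pow, Complex.norm_real, Real.norm_of_nonneg h0]
    refine pow_le_pow_left₀ (by positivity) ?_ 2
    simpa using pow_le_pow_of_le_one h0 h1 hlen

end Poisson

/-! ### Linear maps of tuples -/

section RowMul

variable {n q : ℕ} {H : Type u} [NormedAddCommGroup H] [InnerProductSpace ℂ H]

lemma rowMul_smul (c : ℂ) (X : Tuple n H) (U : Matrix (Fin n) (Fin q) ℂ) :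
    rowMul (c • X) U = c • rowMul X U := by
  funext j
  simp only [rowMul, Pi.smul_apply, Finset.smul_sum, smul_smul, mul_comm]

lemma rowMul_add (X Y : Tuple n H) (U : Matrix (Fin n) (Fin q) ℂ) :
    rowMul (X + Y) U = rowMul X U + rowMul Y U := by
  funext j
  simp only [rowMul, Pi.add_apply, smul_add, Finset.sum_add_distrib]

lemma rowMul_rowMul {p : ℕ} (X : Tuple n H) (U : Matrix (Fin n) (Fin q) ℂ)
    (V : Matrix (Fin q) (Fin p) ℂ) : rowMul (rowMul X U) V = rowMul X (U * V) := by
  funext j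
  simp only [rowMul, Finset.smul_sum, Matrix.mul_apply, Finset.sum_smul, smul_smul]
  rw [Finset.sum_comm]
  exact Finset.sum_congr rfl fun i _ => Finset.sum_congr rfl fun k _ => by rw [mul_comm]

lemma rowMul_sub (X Y : Tuple n H) (U : Matrix (Fin n) (Fin q) ℂ) :
    rowMul (X - Y) U = rowMul X U - rowMul Y U := by
  funext j
  simp only [rowMul, Pi.sub_apply, smul_sub, Finset.sum_sub_distrib]

lemma rowMul_one (X : Tuple n H) : rowMul X (1 : Matrix (Fin n) (Fin n) ℂ) = X := by
  funext j
  simp [rowMul, Matrix.one_apply]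

lemma continuous_rowMul (U : Matrix (Fin n) (Fin q) ℂ) :
    Continuous fun X : Tuple n H => rowMul X U := by
  unfold rowMul
  fun_prop

/-- The coefficients of the `j`-th entry of the linear map `X ↦ X U`. -/
def linearCoeff (U : Matrix (Fin n) (Fin q) ℂ) (j : Fin q) : Word n → ℂ
  | [i] => U i j
  | _ => 0

lemma seriesHasSum_rowMul (U : Matrix (Fin n) (Fin q) ℂ) (X : Tuple n H) (j : Fin q) :
    SeriesHasSum (linearCoeff U j) X (rowMul X U j) := by
  refine tendsto_const_nhds.congr' (eventually_atTop.2 ⟨2, fun N hN => ?_⟩)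
  obtain ⟨N, rfl⟩ := Nat.exists_eq_add_of_le' hN
  beta_reduce
  rw [Finset.sum_range_succ', Finset.sum_range_succ', Finset.sum_eq_zero]
  · rw [← (Equiv.funUnique (Fin 1) (Fin n)).symm.sum_comp]
    simp [rowMul, wordProd, List.ofFn_succ, linearCoeff]
  · intro k _
    refine Finset.sum_eq_zero fun w _ => ?_
    simp [List.ofFn_succ, linearCoeff]

lemma tendsto_radius :
    Tendsto (fun k : ℕ => ((1 - 1 / ((k : ℝ) + 1) : ℝ) : ℂ)) atTop (𝓝 1) := by
  have h : Tendsto (fun k : ℕ => 1 - 1 / ((k : ℝ) + 1)) atTop (𝓝 (1 - 0)) :=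
    tendsto_const_nhds.sub tendsto_one_div_add_atTop_nhds_zero_nat
  simpa [Function.comp_def] using (Complex.continuous_ofReal.tendsto _).comp h

lemma tendsto_radial (X : Tuple n H) :
    Tendsto (fun k : ℕ => ((1 - 1 / ((k : ℝ) + 1) : ℝ) : ℂ) • X) atTop (𝓝 X) := by
  simpa only [one_smul] using tendsto_radius.smul_const X

end RowMul

/-! ### Linear maps between the domains -/

section Linear

variable {n q : ℕ} {f : PositiveRegular n} {g : PositiveRegular q} {m l : ℕ}
  {H : Type u} [NormedAddCommGroup H] [InnerProductSpace ℂ H] [CompleteSpace H]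

lemma radial_nonneg (k : ℕ) : 0 ≤ 1 - 1 / ((k : ℝ) + 1) := by
  rw [sub_nonneg, div_le_one (by positivity)]
  linarith [(Nat.cast_nonneg k : (0 : ℝ) ≤ k)]

lemma radial_lt_one (k : ℕ) : 1 - 1 / ((k : ℝ) + 1) < 1 := sub_lt_self _ (by positivity)

/-- Von Neumann type inequality: a linear map sends `D_f^m(H)` to `D_g^l(H)` as soon as it sends
the universal model of `D_f^m` to `D_g^l`. -/
theorem mapsTo_rowMul (hm : 1 ≤ m) (hf : IsStarlike (domain f m H))
    (hg : IsClosed (domain g l H)) {U : Matrix (Fin n) (Fin q) ℂ}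
    (hU : rowMul (model f m) U ∈ domain g l (Fock n)) :
    Set.MapsTo (fun X : Tuple n H => rowMul X U) (domain f m H) (domain g l H) := by
  intro X hX
  refine hg.mem_of_tendsto (((continuous_rowMul U).tendsto X).comp (tendsto_radial X))
    (Eventually.of_forall fun k => ?_)
  have hb := phiBound_smul (phiBound_one_of_mem_domain hm hX) (radial_nonneg k)
    (radial_lt_one k).le
  obtain ⟨ι, K, hK⟩ := exists_poissonKernel hm
    (hf X hX _ (radial_nonneg k) (radial_lt_one k)) hb
    ((mul_one _).trans_lt (pow_lt_one₀ (radial_nonneg k) (radial_lt_one k) two_ne_zero))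
  exact (hK.rowMul_rowMul U).mem_domain hU

lemma isFreeHolomorphic_of_eq_rowMul (hf : IsStarlike (domain f m H))
    {F : Tuple n H → Tuple q H} {U : Matrix (Fin n) (Fin q) ℂ}
    (hF : ∀ X ∈ domain f m H, F X = rowMul X U) : IsFreeHolomorphic f m F := by
  refine ⟨linearCoeff U, ?_, ?_⟩
  · intro K _ _ _ X _ j
    exact ⟨_, seriesHasSum_rowMul U X j⟩
  · rintro X ⟨r, h0, h1, Y, hY, rfl⟩ j
    rw [hF _ (hf Y hY r h0 h1)]
    exact seriesHasSum_rowMul U _ j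

lemma zero_mem_domain : (0 : Tuple n H) ∈ domain f m H := by
  obtain ⟨δ, hδ, h⟩ := exists_pos_phiBound_mem_domain (H := H) f m
  refine h 0 ⟨hδ.le, fun x s => ?_⟩
  rw [Finset.sum_eq_zero]
  · positivity
  · rintro (_ | ⟨i, α⟩) _
    · simp [f.coeff_nil]
    · simp [wordAdj_cons]

theorem isFreeBiholomorphic_of_eq_rowMul (hm : 1 ≤ m) (hl : 1 ≤ l)
    (hf_closed : IsClosed (domain f m H)) (hf_star : IsStarlike (domain f m H))
    (hg_closed : IsClosed (domain g l H)) (hg_star : IsStarlike (domain g l H))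
    {F : Tuple n H → Tuple q H} {U : Matrix (Fin n) (Fin q) ℂ} {V : Matrix (Fin q) (Fin n) ℂ}
    (hUV : U * V = 1) (hVU : V * U = 1) (hF : ∀ X ∈ domain f m H, F X = rowMul X U)
    (hU : rowMul (model f m) U ∈ domain g l (Fock n))
    (hV : rowMul (model g l) V ∈ domain f m (Fock q)) :
    IsFreeBiholomorphic f m g l F ∧ F 0 = 0 := by
  have hFmap := mapsTo_rowMul hm hf_star hg_closed hU
  have hGmap := mapsTo_rowMul hl hg_star hf_closed hV
  refine ⟨⟨fun Y => rowMul Y V, fun X hX => ?_, hGmap, ⟨fun X hX => ?_, fun Y hY => ?_⟩,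
    (continuous_rowMul U).continuousOn.congr hF, (continuous_rowMul V).continuousOn,
    isFreeHolomorphic_of_eq_rowMul hf_star hF,
    isFreeHolomorphic_of_eq_rowMul hg_star fun _ _ => rfl⟩, ?_⟩
  · rw [hF X hX]
    exact hFmap hX
  · change rowMul (F X) V = X
    rw [hF X hX, rowMul_rowMul, hUV, rowMul_one]
  · rw [hF _ (hGmap hY), rowMul_rowMul, hVU, rowMul_one]
  · rw [hF 0 zero_mem_domain]
    funext j
    simp [rowMul]

end Linear

/-! ### Nilpotent tuples -/

section Nilpotent

variable {n q : ℕ} {H : Type u} [NormedAddCommGroup H] [InnerProductSpace ℂ H]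

/-- The span of the products of at least `s` entries of `X`. -/
def wordSpan (X : Tuple n H) (s : ℕ) : Submodule ℂ (H →L[ℂ] H) :=
  Submodule.span ℂ (wordProd X '' {α | s ≤ α.length})

/-- All products of `s` or more entries of `X` vanish. -/
def IsNil (X : Tuple n H) (s : ℕ) : Prop := ∀ α : Word n, s ≤ α.length → wordProd X α = 0

variable {X : Tuple n H} {s t : ℕ}

lemma wordProd_mem_wordSpan {α : Word n} (h : s ≤ α.length) : wordProd X α ∈ wordSpan X s :=
  Submodule.subset_span ⟨α, h, rfl⟩

lemma wordSpan_anti (h : s ≤ t) : wordSpan X t ≤ wordSpan X s :=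
  Submodule.span_mono (Set.image_mono fun _ hα => h.trans hα)

lemma IsNil.eq_zero (hX : IsNil X s) {A : H →L[ℂ] H} (hA : A ∈ wordSpan X s) : A = 0 := by
  have : wordSpan X s ≤ ⊥ := Submodule.span_le.2 (by
    rintro _ ⟨α, hα, rfl⟩
    exact hX α hα)
  exact (Submodule.mem_bot ℂ).1 (this hA)

lemma mul_mem_wordSpan {A B : H →L[ℂ] H} (hA : A ∈ wordSpan X s) (hB : B ∈ wordSpan X t) :
    A * B ∈ wordSpan X (s + t) := by
  have h := Submodule.mul_mem_mul hA hB
  rw [wordSpan, wordSpan, Submodule.span_mul_span] at h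
  refine Submodule.span_mono ?_ h
  rintro _ ⟨_, ⟨α, hα, rfl⟩, _, ⟨β, hβ, rfl⟩, rfl⟩
  exact ⟨α ++ β, by simpa using Nat.add_le_add hα hβ, wordProd_append X α β⟩

lemma wordProd_mem_of_entries {Y : Tuple q H} (hY : ∀ j, Y j ∈ wordSpan X 1) (β : Word q) :
    wordProd Y β ∈ wordSpan X β.length := by
  induction β with
  | nil => exact wordProd_nil Y ▸ wordProd_nil X ▸ wordProd_mem_wordSpan le_rfl
  | cons j β ih =>
    rw [wordProd_cons, List.length_cons, add_comm]
    exact mul_mem_wordSpan (hY j) ih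

lemma IsNil.of_entries (hX : IsNil X s) {Y : Tuple q H} (hY : ∀ j, Y j ∈ wordSpan X 1) :
    IsNil Y s := fun β hβ =>
  hX.eq_zero (wordSpan_anti hβ (wordProd_mem_of_entries hY β))

lemma entry_mem_wordSpan (i : Fin n) : X i ∈ wordSpan X 1 := by
  have := wordProd_mem_wordSpan (X := X) (s := 1) (α := [i]) le_rfl
  simpa [wordProd] using this

lemma rowMul_mem_wordSpan {Y : Tuple q H} (hY : ∀ j, Y j ∈ wordSpan X s) {p : ℕ}
    (U : Matrix (Fin q) (Fin p) ℂ) (j : Fin p) : rowMul Y U j ∈ wordSpan X s :=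
  Submodule.sum_mem _ fun i _ => Submodule.smul_mem _ _ (hY i)

/-- A perturbation of `X` by entries of degree `e + 1` changes words of length `s` only in
degrees at least `s + e`. -/
lemma wordProd_add_sub_mem {E : Tuple n H} {e : ℕ} (hE : ∀ i, E i ∈ wordSpan X (e + 1))
    (α : Word n) : wordProd (X + E) α - wordProd X α ∈ wordSpan X (α.length + e) := by
  induction α with
  | nil => simp
  | cons i α ih =>
    have h1 := mul_mem_wordSpan (entry_mem_wordSpan (X := X) i) ih
    have h2 : E i * wordProd (X + E) α ∈ wordSpan X (e + 1 + α.length) :=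
      mul_mem_wordSpan (hE i) (wordProd_mem_of_entries (fun j => Submodule.add_mem _
        (entry_mem_wordSpan j) (wordSpan_anti (by omega) (hE j))) α)
    have e1 : wordProd (X + E) (i :: α) - wordProd X (i :: α) =
        X i * (wordProd (X + E) α - wordProd X α) + E i * wordProd (X + E) α := by
      rw [wordProd_cons, wordProd_cons, Pi.add_apply, add_mul, mul_sub]
      abel
    rw [e1]
    refine Submodule.add_mem _ (wordSpan_anti (le_of_eq ?_) h1) (wordSpan_anti (le_of_eq ?_) h2)
    all_goals simp only [List.length_cons]; omega

end Nilpotent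

/-! ### Homogeneous parts of free power series -/

section HomogeneousPart

variable {n q : ℕ} {H : Type u} [NormedAddCommGroup H] [InnerProductSpace ℂ H]
  {c : Fin q → Word n → ℂ}

/-- The homogeneous part of degree `k` of the formal power series with coefficients `c`. -/
def homPart (c : Fin q → Word n → ℂ) (k : ℕ) (X : Tuple n H) : Tuple q H := fun j =>
  ∑ w : Fin k → Fin n, c j (List.ofFn w) • wordProd X (List.ofFn w)

lemma homPart_mem_wordSpan (k : ℕ) (X : Tuple n H) (j : Fin q) :
    homPart c k X j ∈ wordSpan X k :=
  Submodule.sum_mem _ fun w _ => Submodule.smul_mem _ _ (wordProd_mem_wordSpan (by simp))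

lemma homPart_smul (k : ℕ) (z : ℂ) (X : Tuple n H) :
    homPart c k (z • X) = z ^ k • homPart c k X := by
  funext j
  simp only [homPart, wordProd_smul, List.length_ofFn, Pi.smul_apply, Finset.smul_sum]
  exact Finset.sum_congr rfl fun w _ => smul_comm _ _ _

lemma homPart_zero (X : Tuple n H) (j : Fin q) : homPart c 0 X j = c j [] • 1 := by
  simp [homPart]

lemma homPart_one (X : Tuple n H) :
    homPart c 1 X = rowMul X (Matrix.of fun i j => c j [i]) := by
  funext j
  rw [homPart, ← (Equiv.funUnique (Fin 1) (Fin n)).symm.sum_comp]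
  simp [rowMul, wordProd, List.ofFn_succ]

/-- In the top degree, a homogeneous part does not see perturbations of that degree. -/
lemma homPart_add_eq {k : ℕ} (hk : 2 ≤ k) {X E : Tuple n H} (hX : IsNil X (k + 1))
    (hE : ∀ i, E i ∈ wordSpan X k) : homPart c k (X + E) = homPart c k X := by
  obtain ⟨e, rfl⟩ := Nat.exists_eq_add_of_le' hk
  funext j
  refine Finset.sum_congr rfl fun w _ => ?_
  have h := wordProd_add_sub_mem (e := e + 1) hE (List.ofFn w)
  rw [sub_eq_zero.1 (hX.eq_zero (wordSpan_anti (by simp) h))]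

lemma IsNil.homPart_eq_zero {X : Tuple n H} {p k : ℕ} (hX : IsNil X p) (h : p ≤ k) :
    homPart c k X = 0 :=
  funext fun j => hX.eq_zero (wordSpan_anti h (homPart_mem_wordSpan k X j))

lemma homPart_zero_eq_zero (hc : ∀ j, c j [] = 0) (X : Tuple n H) : homPart c 0 X = 0 := by
  funext j
  rw [homPart_zero, hc, zero_smul]
  rfl

end HomogeneousPart

/-! ### Truncated shifts -/

section Shift

variable {n q : ℕ} {H : Type u} [NormedAddCommGroup H] [InnerProductSpace ℂ H]

/-- The truncated left shifts `e_α ↦ e_{g_i α}` for `|α| < N`, `e_α ↦ 0` for `|α| ≥ N`. -/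
def truncShift (b : HilbertBasis (Word n) ℂ H) (N : ℕ) : Tuple n H := fun i =>
  ∑ α ∈ (wordsUpTo n N).filter (fun α => α.length < N),
    (innerSL ℂ (b α)).smulRight (b (i :: α))

variable (b : HilbertBasis (Word n) ℂ H) (N : ℕ)

lemma truncShift_apply (i : Fin n) (γ : Word n) :
    truncShift b N i (b γ) = if γ.length < N then b (i :: γ) else 0 := by
  have h : ∀ α, ((innerSL ℂ (b α)).smulRight (b (i :: α))) (b γ) =
      if α = γ then b (i :: γ) else 0 := fun α => by
    rw [ContinuousLinearMap.smulRight_apply, innerSL_apply_apply,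
      orthonormal_iff_ite.1 b.orthonormal]
    split_ifs with h
    · rw [one_smul, h]
    · rw [zero_smul]
  simp only [truncShift, sum_apply, h, Finset.sum_ite_eq', Finset.mem_filter, mem_wordsUpTo]
  congr 1
  exact propext ⟨fun h => h.2, fun h => ⟨h.le, h⟩⟩

lemma wordProd_truncShift_apply {α γ : Word n} (h : α.length + γ.length ≤ N) :
    wordProd (truncShift b N) α (b γ) = b (α ++ γ) := by
  induction α with
  | nil => simp
  | cons i α ih =>
    rw [List.length_cons] at h
    rw [wordProd_cons, mul_apply_eq_comp, ih (by omega), truncShift_apply, if_pos]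
    · rfl
    · rw [List.length_append]; omega

lemma wordProd_truncShift_apply_eq_zero {α γ : Word n} (hα : α ≠ [])
    (h : N < α.length + γ.length) : wordProd (truncShift b N) α (b γ) = 0 := by
  induction α with
  | nil => exact absurd rfl hα
  | cons i α ih =>
    rw [List.length_cons] at h
    rw [wordProd_cons, mul_apply_eq_comp]
    by_cases hle : α.length + γ.length ≤ N
    · rw [wordProd_truncShift_apply b N hle, truncShift_apply, if_neg]
      rw [List.length_append]; omega
    · rcases eq_or_ne α [] with rfl | hne
      · rw [List.length_nil] at hle
        rw [wordProd_nil, one_apply_eq_self, truncShift_apply, if_neg (by omega)]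
      · rw [ih hne (by omega), map_zero]

lemma isNil_truncShift : IsNil (truncShift b N) (N + 1) := fun α hα => by
  refine ContinuousLinearMap.ext_on (s := Set.range b)
    ((Submodule.dense_iff_topologicalClosure_eq_top).2 b.dense_span) ?_
  rintro _ ⟨γ, rfl⟩
  rw [wordProd_truncShift_apply_eq_zero b N (by rintro rfl; simp at hα) (by omega)]
  rfl

/-- The coefficients of degree `N` of a free power series can be read off its value at the
truncated shifts. -/
lemma coeff_eq_zero_of_homPart {c : Fin q → Word n → ℂ} {z : ℂ} (hz : z ≠ 0)
    (h : homPart c N (z • truncShift b N) = 0) (j : Fin q) (w : Fin N → Fin n) :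
    c j (List.ofFn w) = 0 := by
  rw [homPart_smul, smul_eq_zero_iff_right (pow_ne_zero _ hz)] at h
  have h1 : ∑ w : Fin N → Fin n, c j (List.ofFn w) • b (List.ofFn w) = 0 := by
    have := congrArg (fun Y : Tuple q H => Y j (b [])) h
    simpa [homPart, wordProd_truncShift_apply] using this
  exact Fintype.linearIndependent_iff.1
    (b.orthonormal.comp _ List.ofFn_injective).linearIndependent _ h1 w

variable [CompleteSpace H]

lemma IsNil.exists_phiBound {X : Tuple n H} {s : ℕ} (hX : IsNil X s) (f : PositiveRegular n) :
    ∃ C, PhiBound f X C := by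
  have h0 : ∀ α, 0 ≤ f.coeff α * ‖wordAdj X α‖ ^ 2 := fun α =>
    mul_nonneg (f.coeff_nonneg α) (by positivity)
  refine ⟨∑ α ∈ wordsUpTo n s, f.coeff α * ‖wordAdj X α‖ ^ 2,
    Finset.sum_nonneg fun α _ => h0 α, fun h t => ?_⟩
  have h1 : ∀ α, f.coeff α * ‖wordAdj X α h‖ ^ 2 ≤
      f.coeff α * ‖wordAdj X α‖ ^ 2 * ‖h‖ ^ 2 := fun α => by
    rw [mul_assoc, ← mul_pow]
    exact mul_le_mul_of_nonneg_left
      (pow_le_pow_left₀ (norm_nonneg _) ((wordAdj X α).le_opNorm h) 2) (f.coeff_nonneg α)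
  rw [Finset.sum_mul]
  calc _ ≤ ∑ α ∈ t, f.coeff α * ‖wordAdj X α‖ ^ 2 * ‖h‖ ^ 2 := Finset.sum_le_sum fun α _ => h1 α
    _ = ∑ α ∈ t ∩ wordsUpTo n s, f.coeff α * ‖wordAdj X α‖ ^ 2 * ‖h‖ ^ 2 := by
        refine (Finset.sum_subset Finset.inter_subset_left fun α hα hα' => ?_).symm
        have hlen : s ≤ α.length := by
          by_contra hlt
          exact hα' (Finset.mem_inter.2 ⟨hα, mem_wordsUpTo.2 (by omega)⟩)
        simp [wordAdj, hX α hlen]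
    _ ≤ _ := Finset.sum_le_sum_of_subset_of_nonneg Finset.inter_subset_right
        fun α _ _ => mul_nonneg (h0 α) (by positivity)

lemma IsNil.exists_smul_mem_domain {X : Tuple n H} {s : ℕ} (hX : IsNil X s)
    (f : PositiveRegular n) (m : ℕ) : ∃ ε : ℂ, ε ≠ 0 ∧ ε • X ∈ domain f m H := by
  obtain ⟨C, hb⟩ := hX.exists_phiBound f
  obtain ⟨δ, hδ, hmem⟩ := exists_pos_phiBound_mem_domain (H := H) f m
  have hC := hb.1
  set ε : ℝ := min 1 (δ / (C + 1)) with hε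
  have hpos : 0 < ε := lt_min one_pos (by positivity)
  have h1 : ε ≤ 1 := min_le_left _ _
  refine ⟨(ε : ℂ), by exact_mod_cast hpos.ne', hmem _ ((phiBound_smul hb hpos.le h1).mono ?_)⟩
  have h2 : ε * (C + 1) ≤ δ := (le_div_iff₀ (by positivity)).1 (min_le_right _ _)
  nlinarith

end Shift

/-! ### Cartan's theorem -/

section Cartan

variable {n q : ℕ} {f : PositiveRegular n} {g : PositiveRegular q} {m l : ℕ}
  {H : Type u} [NormedAddCommGroup H] [InnerProductSpace ℂ H] [CompleteSpace H]

/-- `F` is continuous on `D_f^m(H)` and given on its radial part by the series with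
coefficients `c`. -/
structure HasExpansion (f : PositiveRegular n) (m : ℕ) (F : Tuple n H → Tuple q H)
    (c : Fin q → Word n → ℂ) : Prop where
  continuousOn : ContinuousOn F (domain f m H)
  seriesHasSum : ∀ X ∈ radialDomain f m H, ∀ j, SeriesHasSum (c j) X (F X j)

variable {F : Tuple n H → Tuple q H} {c : Fin q → Word n → ℂ}

/-- If the series terminates on the radial multiples of `X`, its sum at `X` is `F X`, although
`X` itself need not lie in the radial part. -/
lemma HasExpansion.eq_sum (hF : HasExpansion f m F c) (hf : IsStarlike (domain f m H))
    {X : Tuple n H} (hX : X ∈ domain f m H) {p : ℕ}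
    (hp : ∀ k, p ≤ k → homPart c k X = 0) : F X = ∑ k ∈ Finset.range p, homPart c k X := by
  have hr : ∀ r : ℝ, 0 ≤ r → r < 1 →
      F ((r : ℂ) • X) = ∑ k ∈ Finset.range p, homPart c k ((r : ℂ) • X) := by
    intro r h0 h1
    funext j
    have h2 := hF.seriesHasSum _ ⟨r, h0, h1, X, hX, rfl⟩ j
    refine tendsto_nhds_unique h2 (tendsto_const_nhds.congr' ?_)
    refine eventually_atTop.2 ⟨p, fun N hN => ?_⟩
    rw [Finset.sum_apply]
    refine Finset.sum_subset (Finset.range_subset_range.2 hN) fun k _ hk => ?_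
    rw [homPart_smul, hp k (by simpa using hk), smul_zero]
    rfl
  have ht := tendsto_radial X
  have h1 : Tendsto (fun k : ℕ => F (((1 - 1 / ((k : ℝ) + 1) : ℝ) : ℂ) • X)) atTop (𝓝 (F X)) :=
    ((hF.continuousOn X hX).tendsto).comp (tendsto_nhdsWithin_iff.2 ⟨ht,
      Eventually.of_forall fun k => hf X hX _ (radial_nonneg k) (radial_lt_one k)⟩)
  simp only [hr _ (radial_nonneg _) (radial_lt_one _), homPart_smul] at h1
  refine tendsto_nhds_unique h1 ?_
  have hc : Continuous fun z : ℂ => ∑ k ∈ Finset.range p, z ^ k • homPart c k X := by fun_prop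
  simpa [Function.comp_def] using (hc.tendsto 1).comp tendsto_radius

lemma HasExpansion.coeff_nil [Nontrivial H] (hF : HasExpansion f m F c)
    (hf : IsStarlike (domain f m H)) (h0 : F 0 = 0) (j : Fin q) : c j [] = 0 := by
  have hnil : IsNil (0 : Tuple n H) 1 := by
    rintro (_ | ⟨i, α⟩) h
    · simp at h
    · simp [wordProd_cons]
  have h := hF.eq_sum hf zero_mem_domain fun k hk => hnil.homPart_eq_zero hk
  have h1 := congrFun h j
  rw [h0, Finset.sum_range_one, homPart_zero, Pi.zero_apply] at h1
  exact (smul_eq_zero.1 h1.symm).resolve_right one_ne_zero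

/-- `F` preserves nilpotency. -/
lemma HasExpansion.isNil (hF : HasExpansion f m F c) (hf : IsStarlike (domain f m H))
    (hc : ∀ j, c j [] = 0) {X : Tuple n H} (hX : X ∈ domain f m H) {p : ℕ} (hp : IsNil X p) :
    IsNil (F X) p := by
  refine hp.of_entries fun j => ?_
  rw [hF.eq_sum hf hX fun k hk => hp.homPart_eq_zero hk, Finset.sum_apply]
  refine Submodule.sum_mem _ fun k _ => ?_
  rcases Nat.eq_zero_or_pos k with rfl | hk
  · rw [homPart_zero_eq_zero hc]
    exact Submodule.zero_mem _
  · exact wordSpan_anti hk (homPart_mem_wordSpan k X j)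

/-- On tuples that are nilpotent of order two, `F` is its linear part. -/
lemma HasExpansion.eq_rowMul_of_isNil_two (hF : HasExpansion f m F c)
    (hf : IsStarlike (domain f m H)) (hc : ∀ j, c j [] = 0) {X : Tuple n H}
    (hX : X ∈ domain f m H) (hp : IsNil X 2) :
    F X = rowMul X (Matrix.of fun i j => c j [i]) := by
  rw [hF.eq_sum hf hX fun k hk => hp.homPart_eq_zero hk, Finset.sum_range_succ,
    Finset.sum_range_one, homPart_zero_eq_zero hc, zero_add, homPart_one]

lemma eq_one_of_rowMul_eq (b : HilbertBasis (Word n) ℂ H) {A : Matrix (Fin n) (Fin n) ℂ}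
    (hA : ∀ X ∈ domain f m H, IsNil X 2 → rowMul X A = X) : A = 1 := by
  obtain ⟨ε, hε, hmem⟩ := (isNil_truncShift b 1).exists_smul_mem_domain f m
  have hnil : IsNil (ε • truncShift b 1) 2 := fun α hα => by
    rw [wordProd_smul, isNil_truncShift b 1 α hα, smul_zero]
  have h : homPart (linearCoeff (A - 1)) 1 (ε • truncShift b 1) = 0 := by
    rw [homPart_one]
    have h1 := hA _ hmem hnil
    nth_rewrite 2 [← rowMul_one (ε • truncShift b 1)] at h1
    rw [← sub_eq_zero] at h1
    rw [← h1]
    funext j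
    simp [rowMul, linearCoeff, sub_smul, Finset.sum_sub_distrib]
  ext i j
  have := coeff_eq_zero_of_homPart b 1 hε h j (fun _ => i)
  simpa [List.ofFn_succ, linearCoeff, sub_eq_zero] using this

variable {G : Tuple q H → Tuple n H} {d : Fin n → Word q → ℂ}

/-- The linear parts of mutually inverse maps are inverse matrices. -/
lemma linearPart_mul_eq_one (b : HilbertBasis (Word n) ℂ H)
    (hF : HasExpansion f m F c) (hG : HasExpansion g l G d)
    (hf : IsStarlike (domain f m H)) (hg : IsStarlike (domain g l H))
    (hc : ∀ j, c j [] = 0) (hd : ∀ i, d i [] = 0)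
    (hmap : Set.MapsTo F (domain f m H) (domain g l H))
    (hinv : Set.LeftInvOn G F (domain f m H)) :
    (Matrix.of fun i j => c j [i]) * (Matrix.of fun j i => d i [j]) = 1 := by
  refine eq_one_of_rowMul_eq (f := f) (m := m) b fun X hX hnil => ?_
  rw [← rowMul_rowMul, ← hF.eq_rowMul_of_isNil_two hf hc hX hnil,
    ← hG.eq_rowMul_of_isNil_two hg hd (hmap hX) (hF.isNil hf hc hX hnil), hinv hX]

/-- Conjugating a rotation by `F` moves a nilpotent point `X` of the domain, on which `F` is the
sum of its linear part and its part `F_k` of top degree `k`, to `X - 2 F_k(X) V`, where `V` is the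
inverse of the linear part. -/
lemma rotate_mem_domain (hG : HasExpansion g l G d)
    (hg : IsStarlike (domain g l H)) (hd : ∀ i, d i [] = 0)
    (hmapF : Set.MapsTo F (domain f m H) (domain g l H))
    (hmapG : Set.MapsTo G (domain g l H) (domain f m H))
    (hinv : Set.RightInvOn G F (domain g l H))
    {U : Matrix (Fin n) (Fin q) ℂ} {V : Matrix (Fin q) (Fin n) ℂ} (hUV : U * V = 1)
    {k : ℕ} (hk : 2 ≤ k)
    (hFk : ∀ X ∈ domain f m H, IsNil X (k + 1) → F X = rowMul X U + homPart c k X)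
    {X : Tuple n H} (hX : X ∈ domain f m H) (hnil : IsNil X (k + 1)) :
    X - (2 : ℂ) • rowMul (homPart c k X) V ∈ domain f m H ∧
      IsNil (X - (2 : ℂ) • rowMul (homPart c k X) V) (k + 1) ∧
      homPart c k (X - (2 : ℂ) • rowMul (homPart c k X) V) = homPart c k X := by
  obtain ⟨e, rfl⟩ := Nat.exists_eq_add_of_le' hk
  -- Rotating `F_k` by `z` relative to the linear part then just changes its sign.
  obtain ⟨z, hz1, hz⟩ : ∃ z : ℂ, ‖z‖ = 1 ∧ z ^ (e + 1) = -1 := by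
    refine ⟨Complex.exp ((Real.pi / (e + 1) : ℝ) * Complex.I), Complex.norm_exp_ofReal_mul_I _, ?_⟩
    rw [← Complex.exp_nat_mul, ← Complex.exp_pi_mul_I]
    congr 1
    push_cast
    field_simp
  have hz0 : z ≠ 0 := by
    rintro rfl
    simp at hz1
  set P := homPart c (e + 2) X with hP
  have hnilz : IsNil (z • X) (e + 2 + 1) := fun α hα => by
    rw [wordProd_smul, hnil α hα, smul_zero]
  -- `Y = z⁻¹ F(z X)` lies in the second domain, by circularity of both.
  have hY : rowMul X U - P ∈ domain g l H := by
    have h1 := smul_mem_domain (z := z⁻¹) (by simp [hz1]) (hmapF (smul_mem_domain hz1 hX))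
    rw [hFk _ (smul_mem_domain hz1 hX) hnilz, rowMul_smul, homPart_smul, smul_add,
      inv_smul_smul₀ hz0, smul_smul, show z ^ (e + 2) = z * z ^ (e + 1) from pow_succ' z _,
      inv_mul_cancel_left₀ hz0, hz, neg_one_smul, ← sub_eq_add_neg] at h1
    exact h1
  have hPmem : ∀ j, P j ∈ wordSpan X (e + 2) := homPart_mem_wordSpan _ X
  have hYent : ∀ j, (rowMul X U - P) j ∈ wordSpan X 1 := fun j =>
    Submodule.sub_mem _ (rowMul_mem_wordSpan entry_mem_wordSpan U j)
      (wordSpan_anti (by omega) (hPmem j))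
  set Z := G (rowMul X U - P) with hZ
  have hZmem : Z ∈ domain f m H := hmapG hY
  have hZnil : IsNil Z (e + 2 + 1) := hG.isNil hg hd hY (hnil.of_entries hYent)
  have hFZ : rowMul Z U + homPart c (e + 2) Z = rowMul X U - P := by
    rw [← hFk Z hZmem hZnil, hZ, hinv hY]
  -- Apply `V` to `F(Z) = Y` and compare the parts of top degree.
  have hYV := congrArg (fun Y => rowMul Y V) hFZ
  simp only [rowMul_add, rowMul_sub, rowMul_rowMul, hUV, rowMul_one] at hYV
  have h1 := homPart_add_eq (c := c) hk hZnil
    (rowMul_mem_wordSpan (homPart_mem_wordSpan (c := c) (e + 2) Z) V)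
  have h2 := homPart_add_eq (c := c) hk (E := -rowMul P V) hnil
    fun i => Submodule.neg_mem _ (rowMul_mem_wordSpan hPmem V i)
  have hZP : homPart c (e + 2) Z = P := by
    rw [← h1, show Z + rowMul (homPart c (e + 2) Z) V = X + -rowMul P V by
      rw [← sub_eq_add_neg]; exact hYV, h2]
  have hZeq : X - (2 : ℂ) • rowMul P V = Z := by
    rw [hZP] at hYV
    rw [eq_sub_of_add_eq hYV, two_smul]
    abel
  rw [hZeq]
  exact ⟨hZmem, hZnil, hZP⟩

/-- Iterating `rotate_mem_domain` would leave the bounded domain unless the part of top degree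
vanishes. -/
lemma homPart_eq_zero_of_isNil (hm : 1 ≤ m)
    (hG : HasExpansion g l G d) (hg : IsStarlike (domain g l H)) (hd : ∀ i, d i [] = 0)
    (hmapF : Set.MapsTo F (domain f m H) (domain g l H))
    (hmapG : Set.MapsTo G (domain g l H) (domain f m H))
    (hinv : Set.RightInvOn G F (domain g l H))
    {U : Matrix (Fin n) (Fin q) ℂ} {V : Matrix (Fin q) (Fin n) ℂ} (hUV : U * V = 1)
    (hVU : V * U = 1) {k : ℕ} (hk : 2 ≤ k)
    (hFk : ∀ X ∈ domain f m H, IsNil X (k + 1) → F X = rowMul X U + homPart c k X)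
    {X : Tuple n H} (hX : X ∈ domain f m H) (hnil : IsNil X (k + 1)) : homPart c k X = 0 := by
  set E := rowMul (homPart c k X) V with hE
  have hiter : ∀ N : ℕ, X - (2 * N : ℂ) • E ∈ domain f m H ∧
      IsNil (X - (2 * N : ℂ) • E) (k + 1) ∧
      homPart c k (X - (2 * N : ℂ) • E) = homPart c k X := by
    intro N
    induction N with
    | zero => simpa using ⟨hX, hnil⟩
    | succ N ih =>
      have h := rotate_mem_domain hG hg hd hmapF hmapG hinv hUV hk hFk ih.1 ih.2.1
      rw [ih.2.2, ← hE, sub_sub, ← add_smul] at h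
      push_cast
      rwa [mul_add, mul_one]
  have hE0 : E = 0 := by
    funext i
    by_contra hne
    obtain ⟨N, hN⟩ := exists_nat_gt ((‖X i‖ + √(1 / f.coeff [i])) / ‖E i‖)
    rw [div_lt_iff₀ (norm_pos_iff.2 hne)] at hN
    have h1 := norm_le_of_mem_domain hm (hiter N).1 i
    have h2 : ‖(2 * N : ℂ) • E i‖ ≤ ‖X i‖ + ‖(X - (2 * N : ℂ) • E) i‖ := by
      have := norm_sub_le (X i) ((X - (2 * N : ℂ) • E) i)
      simpa using this
    rw [norm_smul] at h2
    have h3 : ‖(2 * N : ℂ)‖ = 2 * N := by simp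
    rw [h3] at h2
    nlinarith [norm_nonneg (E i), (Nat.cast_nonneg N : (0 : ℝ) ≤ N)]
  rw [← rowMul_one (homPart c k X), ← hVU, ← rowMul_rowMul, ← hE, hE0]
  funext j
  simp [rowMul]

/-- Cartan's theorem: a free biholomorphic function fixing the origin is linear. -/
theorem eq_rowMul_of_biholomorphic (hm : 1 ≤ m) (b : HilbertBasis (Word n) ℂ H)
    (hF : HasExpansion f m F c) (hG : HasExpansion g l G d)
    (hf : IsStarlike (domain f m H)) (hg : IsStarlike (domain g l H))
    (hc : ∀ j, c j [] = 0) (hd : ∀ i, d i [] = 0)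
    (hmapF : Set.MapsTo F (domain f m H) (domain g l H))
    (hmapG : Set.MapsTo G (domain g l H) (domain f m H))
    (hinv : Set.RightInvOn G F (domain g l H))
    {V : Matrix (Fin q) (Fin n) ℂ} (hUV : (Matrix.of fun i j => c j [i]) * V = 1)
    (hVU : V * (Matrix.of fun i j => c j [i]) = 1) {X : Tuple n H} (hX : X ∈ domain f m H) :
    F X = rowMul X (Matrix.of fun i j => c j [i]) := by
  have hzero : ∀ k, 2 ≤ k → ∀ Y : Tuple n H, homPart c k Y = 0 := by
    intro k
    induction k using Nat.strong_induction_on with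
    | _ k ih =>
      intro hk
      have hFk : ∀ X ∈ domain f m H, IsNil X (k + 1) →
          F X = rowMul X (Matrix.of fun i j => c j [i]) + homPart c k X := by
        intro X hX hnil
        rw [hF.eq_sum hf hX fun k hk => hnil.homPart_eq_zero hk, Finset.sum_range_succ,
          ← homPart_one]
        congr 1
        refine Finset.sum_eq_single_of_mem 1 (by simp; omega) fun i hi hne => ?_
        rcases Nat.eq_zero_or_pos i with rfl | hpos
        · exact homPart_zero_eq_zero hc X
        · exact ih i (by simpa using hi) (by omega) X
      obtain ⟨ε, hε, hmem⟩ := (isNil_truncShift b k).exists_smul_mem_domain f m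
      have hnil : IsNil (ε • truncShift b k) (k + 1) := fun α hα => by
        rw [wordProd_smul, isNil_truncShift b k α hα, smul_zero]
      have hcoef := coeff_eq_zero_of_homPart b k hε (homPart_eq_zero_of_isNil hm hG hg hd
        hmapF hmapG hinv hUV hVU hk hFk hmem hnil)
      intro Y
      funext j
      exact Finset.sum_eq_zero fun w _ => by rw [hcoef, zero_smul]
  rw [hF.eq_sum hf hX fun k hk => hzero k hk X, Finset.sum_range_succ, Finset.sum_range_one,
    homPart_zero_eq_zero hc, zero_add, homPart_one]

end Cartan

/-! ### From the given Hilbert space to the Fock space -/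

section Transfer

variable {n q : ℕ} {f : PositiveRegular n} {g : PositiveRegular q} {m l : ℕ}
  {H : Type u} [NormedAddCommGroup H] [InnerProductSpace ℂ H] [CompleteSpace H]

/-- The universal model can be realized on `H` as soon as `H` is unitarily equivalent to the Fock
space, so linear maps between domains over `H` act on it. -/
lemma rowMul_model_mem_domain (hm : 1 ≤ m) (b : HilbertBasis (Word n) ℂ H)
    {U : Matrix (Fin n) (Fin q) ℂ}
    (hU : ∀ X ∈ domain f m H, rowMul X U ∈ domain g l H) :
    rowMul (model f m) U ∈ domain g l (Fock n) := by
  let J : H ≃ₗᵢ[ℂ] Fock n := b.repr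
  let J₁ : H →L[ℂ] Fock n := J.toContinuousLinearEquiv
  let J₂ : Fock n →L[ℂ] H := J.symm.toContinuousLinearEquiv
  let X : Tuple n H := fun i => ContinuousLinearMap.adjoint
    (J₂.comp ((ContinuousLinearMap.adjoint (model f m i)).comp J₁))
  have hX : ∀ i h, ContinuousLinearMap.adjoint (X i) h =
      J.symm (ContinuousLinearMap.adjoint (model f m i) (J h)) := fun i h => by
    simp only [X, ContinuousLinearMap.adjoint_adjoint]
    rfl
  have h1 := (isKernelFamily_of_unitary J (X := X) (W := model f m)
    fun i h => by rw [hX, J.apply_symm_apply]).mem_domain (model_mem_domain f hm)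
  have h2 := isKernelFamily_of_unitary J.symm (X := model f m) (W := X)
    fun i y => by rw [hX, J.apply_symm_apply]
  exact (h2.rowMul_rowMul U).mem_domain (hU X h1)

end Transfer

/-! ### Orthonormal bases indexed by words -/

section Basis

variable (H : Type u) [NormedAddCommGroup H] [InnerProductSpace ℂ H]

lemma countable_of_orthonormal [TopologicalSpace.SeparableSpace H] {ι : Type*} {v : ι → H}
    (hv : Orthonormal ℂ v) : Countable ι := by
  have hd : Pairwise fun i j =>
      Disjoint (Metric.ball (v i) (1 / 2)) (Metric.ball (v j) (1 / 2)) := by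
    intro i j hij
    refine Metric.ball_disjoint_ball ?_
    rw [dist_eq_norm]
    have h1 : ‖v i - v j‖ * ‖v i - v j‖ = 2 := by
      rw [norm_sub_mul_self (𝕜 := ℂ), hv.1, hv.1, hv.2 hij]
      norm_num
    nlinarith [norm_nonneg (v i - v j)]
  have := Set.PairwiseDisjoint.countable_of_isOpen (a := Set.univ)
    (s := fun i => Metric.ball (v i) (1 / 2)) (fun i _ j _ hij => hd hij)
    (fun _ _ => Metric.isOpen_ball) fun i _ => ⟨v i, Metric.mem_ball_self (by norm_num)⟩
  exact Set.countable_univ_iff.1 this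

/-- A separable infinite dimensional Hilbert space has an orthonormal basis indexed by the words
in at least one letter. -/
lemma exists_hilbertBasis_word [CompleteSpace H] [TopologicalSpace.SeparableSpace H]
    (hH : ¬ FiniteDimensional ℂ H) {n : ℕ} (hn : 1 ≤ n) :
    Nonempty (HilbertBasis (Word n) ℂ H) := by
  obtain ⟨w, b, -⟩ := exists_hilbertBasis ℂ H
  have : Countable w := countable_of_orthonormal H b.orthonormal
  have : Infinite w := by
    rw [← not_finite_iff_infinite]
    intro hfin
    have := Fintype.ofFinite w
    exact hH (Module.Basis.finiteDimensional_of_finite b.toOrthonormalBasis.toBasis)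
  have : Nonempty (Fin n) := ⟨⟨0, hn⟩⟩
  have : Infinite (Word n) := inferInstance
  obtain ⟨e⟩ : Nonempty (Word n ≃ w) := nonempty_equiv_of_countable
  refine ⟨HilbertBasis.mk (b.orthonormal.comp e e.injective) ?_⟩
  rw [e.surjective.range_comp, b.dense_span]

end Basis

end NCDomain

end

theorem theorem4p5 {n q m l : ℕ} (hn : 1 ≤ n) (hq : 1 ≤ q) (hm : 1 ≤ m) (hl : 1 ≤ l)
    (f : PositiveRegular n) (g : PositiveRegular q)
    {H : Type*} [NormedAddCommGroup H] [InnerProductSpace ℂ H] [CompleteSpace H]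
    [TopologicalSpace.SeparableSpace H] (hH : ¬ FiniteDimensional ℂ H)
    (hf_closed : IsClosed (domain f m H)) (hf_star : IsStarlike (domain f m H))
    (hg_closed : IsClosed (domain g l H)) (hg_star : IsStarlike (domain g l H))
    (F : Tuple n H → Tuple q H) :
    (IsFreeBiholomorphic f m g l F ∧ F 0 = 0) ↔
      n = q ∧ ∃ (U : Matrix (Fin n) (Fin q) ℂ) (V : Matrix (Fin q) (Fin n) ℂ),
        U * V = 1 ∧ V * U = 1 ∧
        (∀ X ∈ domain f m H, F X = rowMul X U) ∧
        rowMul (model f m) U ∈ domain g l (Fock n) ∧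
        rowMul (model g l) V ∈ domain f m (Fock q) := by
  constructor
  · rintro ⟨⟨G, hmapF, hmapG, ⟨hGF, hFG⟩, hcF, hcG, ⟨c, -, hc⟩, ⟨d, -, hd⟩⟩, hF0⟩
    obtain ⟨b⟩ := exists_hilbertBasis_word H hH hn
    obtain ⟨b'⟩ := exists_hilbertBasis_word H hH hq
    have : Nontrivial H := by
      by_contra h
      rw [not_nontrivial_iff_subsingleton] at h
      exact hH inferInstance
    have hFe : HasExpansion f m F c := ⟨hcF, hc⟩
    have hGe : HasExpansion g l G d := ⟨hcG, hd⟩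
    have hG0 : G 0 = 0 := by simpa only [hF0] using hGF (zero_mem_domain (f := f) (m := m))
    have hc0 := hFe.coeff_nil hf_star hF0
    have hd0 := hGe.coeff_nil hg_star hG0
    have hUV := linearPart_mul_eq_one b hFe hGe hf_star hg_star hc0 hd0 hmapF hGF
    have hVU := linearPart_mul_eq_one b' hGe hFe hg_star hf_star hd0 hc0 hmapG hFG
    have hF : ∀ X ∈ domain f m H, F X = rowMul X (Matrix.of fun i j => c j [i]) := fun X hX =>
      eq_rowMul_of_biholomorphic hm b hFe hGe hf_star hg_star hc0 hd0 hmapF hmapG hFG hUV hVU hX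
    have hG : ∀ Y ∈ domain g l H, G Y = rowMul Y (Matrix.of fun j i => d i [j]) := fun Y hY =>
      eq_rowMul_of_biholomorphic hl b' hGe hFe hg_star hf_star hd0 hc0 hmapG hmapF hGF hVU hUV hY
    refine ⟨by simpa using Matrix.square_of_invertible _ _ hUV hVU, _, _, hUV, hVU, hF,
      rowMul_model_mem_domain hm b fun X hX => ?_, rowMul_model_mem_domain hl b' fun Y hY => ?_⟩
    · rw [← hF X hX]
      exact hmapF hX
    · rw [← hG Y hY]
      exact hmapG hY
  · rintro ⟨-, U, V, hUV, hVU, hF, hU, hV⟩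
    exact isFreeBiholomorphic_of_eq_rowMul hm hl hf_closed hf_star hg_closed hg_star hUV hVU hF
      hU hV
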